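/- **Setting.** Let $\mathbb T=\mathbb N_0\cup\{\infty\}$, let $(\Omega,\mathcal F,(\mathcal F_t)_{t\in\mathbb N_0},P)$ be a filtered probability space with $\mathcal F_0=\{\emptyset,\Omega\}$, and put $\mathcal F_\infty=\sigma(\bigcup_{t\in\mathbb N_0}\mathcal F_t)$. (In)equalities between random variables hold $P$-a.s. unless another measure is named. Let $\mathcal R^\infty$ be the space of adapted processes $X=(X_t)_{t\in\mathbb T}$ that are $P$-essentially bounded uniformly in $t$, let $\pi_t(X)=(1_{\{t\le r\}}X_r)_{r\in\mathbb T}$ and $\mathcal R^\infty_t=\pi_t(\mathcal R^\infty)$, and let $L^\infty_t=L^\infty(\Omega,\mathcal F_t,P)$. A *conditional convex risk measure* is a map $\rho_t:\mathcal R^\infty_t\to L^\infty_t$ such that for all $X,Y\in\mathcal R^\infty_t$: $\rho_t(X+m1_{\{t,t+1,\dots,\infty\}})=\rho_t(X)-m$ for all $m\in L^\infty_t$; $\rho_t(X)\ge\rho_t(Y)$ if $X\le Y$; $\rho_t(\lambda X+(1-\lambda)Y)\le\lambda\rho_t(X)+(1-\lambda)\rho_t(Y)$ for all $\lambda\in L^\infty_t$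 with $0\le\lambda\le1$; and $\rho_t(0)=0$. For $X\in\mathcal R^\infty$ put $\rho_t(X):=\rho_t(\pi_t(X))$. It is *continuous from above* if $\rho_t(X^n)\nearrow\rho_t(X)$ $P$-a.s. whenever $X^n,X\in\mathcal R^\infty$ and $X^n_s\searrow X_s$ $P$-a.s. for all $s\in\mathbb T$ with $s\ge t$. A *dynamic convex risk measure* is a sequence $(\rho_t)_{t\in\mathbb N_0}$ of conditional convex risk measures; it is *time consistent* if for all $t\in\mathbb N_0$ and $X,Y\in\mathcal R^\infty$, $X_t=Y_t$ and $\rho_{t+1}(X)\le\rho_{t+1}(Y)$ imply $\rho_t(X)\le\rho_t(Y)$. A *model* $\bar Q=Q\otimes D$ is given by a probability measure $Q$ on $(\Omega,\mathcal F)$ with $Q\ll P$ on each $\mathcal F_t$, $t\in\mathbb N_0$, and a process $D=(D_t)_{t\in\mathbb T}$ such that $D_0$ is $\mathcal F_0$-measurable, $D_{t+1}$ is $\mathcal F_t$-measurable for $t\in\mathbb N_0$, $D_\infty$ is $\mathcal F_\infty$-measurable and, $Q$-a.s., $D_0=1$, $(D_t)_{t\in\mathbb N_0}$ is non-increasing,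 $D_\infty=\lim_{t\to\infty}D_t\ge0$, and $D_\infty=0$ on $\{M_\infty=\infty\}$, where $M_\infty=\lim_t M_t$ and $M_t=\frac{dQ}{dP}\big|_{\mathcal F_t}$. With $\gamma_t=D_t-D_{t+1}$ $(t\in\mathbb N_0)$ and $\gamma_\infty=D_\infty$, $\bar Q$ is identified with the measure $E_{\bar Q}[X]=E_Q\big[\sum_{t\in\mathbb T}\gamma_tX_t\big]$ on the optional $\sigma$-field $\sigma(A\times\{t\}: t\in\mathbb T,\ A\in\mathcal F_t)$ on $\Omega\times\mathbb T$; $\bar R\ll\bar Q$ is understood on this $\sigma$-field. The (minimal) penalty of $\bar Q=Q\otimes D$ at time $t\in\mathbb N_0$ is $$\alpha_t(\bar Q)=Q\text{-}\operatorname{ess\,sup}\Big\{E_Q\Big[-\sum_{s\in\mathbb T,\,s\ge t}\frac{\gamma_s}{D_t}X_s\,\Big|\,\mathcal F_t\Big]:\ X\in\mathcal R^\infty_t,\ \rho_t(X)\le0\Big\}\ \text{ on }\{D_t>0\},\qquad \alpha_t(\bar Q)=\infty\ \text{ on }\{D_t=0\},$$ and $0\cdot\infty:=0$. If $\alpha_0(\bar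 Q)<\infty$, the *bubble* of $\bar Q$ is the process $N^{Q,D}_t=\lim_{s\to\infty}E_Q[D_s\alpha_s(\bar Q)\,|\,\mathcal F_t]$, $t\in\mathbb N_0$, i.e. the martingale part in the Riesz decomposition of $(D_t\alpha_t(\bar Q))_{t\in\mathbb N_0}$ under $Q$; $\bar Q$ *has no bubble* if $N^{Q,D}_t=0$ $Q$-a.s. for all $t\in\mathbb N_0$. A *$Q$-potential* is a nonnegative $Q$-supermartingale $(Z_t)_{t\in\mathbb N_0}$ with $\lim_{t\to\infty}E_Q[Z_t]=0$. **Theorem.** Let $(\rho_t)_{t\in\mathbb N_0}$ be a time consistent dynamic convex risk measure such that each $\rho_t$ is continuous from above, and let $\bar Q=Q\otimes D$ be a model with $\alpha_0(\bar Q)<\infty$. Then for each $X\in\mathcal R^\infty$ the limit $\rho_\infty(X)=\lim_{t\to\infty}\rho_t(X)$ exists in $\mathbb R$ $Q$-a.s. on $\{D_\infty>0\}$, and the following are equivalent: 1. $(\rho_t)$ is asymptotically safe under $\bar Q$: for every $X\in\mathcal R^\infty$, $\rho_\infty(X)\ge-X_\infty$ $Q$-a.s. on $\{D_\infty>0\}$;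 2. $\bar Q$ has no bubble, i.e. $N^{Q,D}$ vanishes; 3. $(D_t\alpha_t(\bar Q))_{t\in\mathbb N_0}$ is a $Q$-potential; 4. no model $\bar R=R\otimes E$ with $\bar R\ll\bar Q$ and $\alpha_0(\bar R)<\infty$ has a bubble, i.e. $N^{R,E}$ vanishes for every such model. -/

import Mathlib

open MeasureTheory Filter Topology Set
open scoped ENNReal

noncomputable section

namespace RiskProcess

/-! ### Essential suprema of arbitrary families -/

/-- `g` is the essential supremum under `μ` of the family `S` of extended real valued functions:
the `μ`-a.s. least upper bound of `S`, chosen measurable with respect to the `σ`-field `m'`. -/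
structure IsEssSupFamily {Ω : Type*} {m : MeasurableSpace Ω} (m' : MeasurableSpace Ω)
    (μ : Measure[m] Ω) (S : Set (Ω → EReal)) (g : Ω → EReal) : Prop where
  measurable : Measurable[m'] g
  upper : ∀ f ∈ S, f ≤ᵐ[μ] g
  least : ∀ h : Ω → EReal, (∀ f ∈ S, f ≤ᵐ[μ] h) → g ≤ᵐ[μ] h

/-- Every family of `m'`-measurable functions has an essential supremum. -/
theorem exists_isEssSupFamily {Ω : Type*} {m : MeasurableSpace Ω} {m' : MeasurableSpace Ω}
    (hm : m' ≤ m) (μ : Measure[m] Ω) [IsFiniteMeasure μ] (S : Set (Ω → EReal))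
    (hS : ∀ f ∈ S, Measurable[m'] f) : ∃ g, IsEssSupFamily m' μ S g := by
  classical
  set φ : EReal → ℝ := fun x =>
    (ENNReal.orderIsoUnitIntervalBirational (EReal.expOrderIso x) : ℝ) with hφ
  have hφm : StrictMono φ := by
    intro a b hab
    exact_mod_cast ENNReal.orderIsoUnitIntervalBirational.strictMono
      (EReal.expOrderIso.strictMono hab)
  have hφ0 : ∀ x, 0 ≤ φ x := fun x =>
    (ENNReal.orderIsoUnitIntervalBirational (EReal.expOrderIso x)).2.1
  have hφ1 : ∀ x, φ x ≤ 1 := fun x =>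
    (ENNReal.orderIsoUnitIntervalBirational (EReal.expOrderIso x)).2.2
  set ψ : EReal → ℝ≥0∞ := fun x => ENNReal.ofReal (φ x) with hψ
  have hψm : Monotone ψ := fun a b hab => ENNReal.ofReal_le_ofReal (hφm.monotone hab)
  have hψi : ∀ a b, ψ a = ψ b → a = b := by
    intro a b hab
    exact hφm.injective ((ENNReal.ofReal_eq_ofReal_iff (hφ0 a) (hφ0 b)).1 hab)
  have hψ1 : ∀ x, ψ x ≤ 1 := fun x => ENNReal.ofReal_le_one.2 (hφ1 x)
  have hψmeas : Measurable ψ := hψm.measurable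
  -- adding the constant `⊥` makes the family non-empty
  set S' : Set (Ω → EReal) := insert ⊥ S with hS'
  have hS'm : ∀ f ∈ S', Measurable[m'] f := by
    rintro f (rfl | hf)
    · exact @measurable_const _ _ _ m' ⊥
    · exact hS f hf
  set G : (ℕ → S') → Ω → EReal := fun c ω => ⨆ n, (c n : Ω → EReal) ω with hG
  have hGm : ∀ c, Measurable[m'] (G c) := fun c =>
    Measurable.iSup fun n => hS'm _ (c n).2
  set I : (ℕ → S') → ℝ≥0∞ := fun c => ∫⁻ ω, ψ (G c ω) ∂μ with hI
  have hne : (range I).Nonempty := ⟨_, ⟨fun _ => ⟨⊥, mem_insert _ _⟩, rfl⟩⟩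
  obtain ⟨u, -, hut, hur⟩ := exists_seq_tendsto_sSup hne (OrderTop.bddAbove _)
  choose c hc using hur
  set d : ℕ → S' := fun n => c n.unpair.1 n.unpair.2 with hd
  have hcd : ∀ k, G (c k) ≤ G d := by
    intro k ω
    refine iSup_le fun n => ?_
    have := le_iSup (fun j => (d j : Ω → EReal) ω) (Nat.pair k n)
    simpa [hd] using this
  have hIle : ∀ e, I e ≤ I d := by
    intro e
    refine (le_sSup (mem_range_self e)).trans (le_of_tendsto' hut fun k => ?_)
    rw [← hc k]
    exact lintegral_mono fun ω => hψm (hcd k ω)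
  have hIfin : I d ≠ ∞ := by
    refine ne_top_of_le_ne_top (measure_ne_top μ univ) ?_
    calc I d ≤ ∫⁻ _, 1 ∂μ := lintegral_mono fun ω => hψ1 _
      _ = μ univ := by simp
  refine ⟨G d, hGm d, fun f hf => ?_, fun h hh => ?_⟩
  · -- adding `f` to the countable subfamily cannot increase the integral
    set e : ℕ → S' := fun n => Nat.casesOn n ⟨f, mem_insert_of_mem _ hf⟩ d with he
    have hde : G d ≤ G e := fun ω => iSup_le fun n =>
      le_iSup (fun j => (e j : Ω → EReal) ω) (n + 1)
    have hfe : f ≤ G e := fun ω => le_iSup (fun j => (e j : Ω → EReal) ω) 0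
    have hae : (fun ω => ψ (G d ω)) =ᵐ[μ] fun ω => ψ (G e ω) :=
      ae_eq_of_ae_le_of_lintegral_le (Eventually.of_forall fun ω => hψm (hde ω)) hIfin
        (hψmeas.comp ((hGm e).mono hm le_rfl)).aemeasurable (hIle e)
    filter_upwards [hae] with ω hω
    rw [hψi _ _ hω]
    exact hfe ω
  · have : ∀ n, (d n : Ω → EReal) ≤ᵐ[μ] h := by
      intro n
      rcases (d n).2 with h0 | hn
      · rw [h0]
        exact Eventually.of_forall fun ω => bot_le
      · exact hh _ hn
    filter_upwards [ae_all_iff.2 this] with ω hω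
    exact iSup_le hω

open Classical in
/-- The essential supremum of a family `S` of `m'`-measurable functions; by
`exists_isEssSupFamily` the default value is never used for such families. -/
def essSupFamily {Ω : Type*} {m : MeasurableSpace Ω} (m' : MeasurableSpace Ω)
    (μ : Measure[m] Ω) (S : Set (Ω → EReal)) : Ω → EReal :=
  if h : ∃ g, IsEssSupFamily m' μ S g then h.choose else ⊤

theorem isEssSupFamily_essSupFamily {Ω : Type*} {m : MeasurableSpace Ω} {m' : MeasurableSpace Ω}
    (hm : m' ≤ m) (μ : Measure[m] Ω) [IsFiniteMeasure μ] (S : Set (Ω → EReal))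
    (hS : ∀ f ∈ S, Measurable[m'] f) : IsEssSupFamily m' μ S (essSupFamily m' μ S) := by
  have h := exists_isEssSupFamily hm μ S hS
  rw [essSupFamily, dif_pos h]
  exact h.choose_spec

/-! ### Processes indexed by `ℕ ∪ {∞}` -/

variable {Ω : Type*} {m : MeasurableSpace Ω}

/-- The `σ`-field `𝓕_t` for `t ∈ ℕ ∪ {∞}`, where `𝓕_∞ = σ(⋃ₙ 𝓕ₙ)`. -/
@[reducible] def sigmaAt (𝓕 : Filtration ℕ m) : ℕ∞ → MeasurableSpace Ω
  | ⊤ => ⨆ n, 𝓕 n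
  | (n : ℕ) => 𝓕 n

theorem sigmaAt_le (𝓕 : Filtration ℕ m) (t : ℕ∞) : sigmaAt 𝓕 t ≤ m := by
  cases t with
  | top => exact iSup_le fun n => 𝓕.le n
  | coe n => exact 𝓕.le n

/-- The space `𝓡^∞` of adapted processes `(X_t)`, `t ∈ ℕ ∪ {∞}`, that are `P`-essentially bounded
uniformly in `t`. Processes are represented by measurable versions; all relations between them
are understood `P`-a.s. -/
def RInf (𝓕 : Filtration ℕ m) (P : Measure Ω) : Set (ℕ∞ → Ω → ℝ) :=
  {X | (∀ t, Measurable[sigmaAt 𝓕 t] (X t)) ∧ ∃ C : ℝ, ∀ t, ∀ᵐ ω ∂P, |X t ω| ≤ C}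

/-- The projection `π_{t,∞}`: `X ↦ (1_{t ≤ r} X_r)_r`. -/
def proj (t : ℕ) (X : ℕ∞ → Ω → ℝ) : ℕ∞ → Ω → ℝ :=
  fun r ω => if (t : ℕ∞) ≤ r then X r ω else 0

/-- The space `𝓡_t^∞ = π_{t,∞}(𝓡^∞)`. -/
def RInfFrom (𝓕 : Filtration ℕ m) (P : Measure Ω) (t : ℕ) : Set (ℕ∞ → Ω → ℝ) :=
  proj t '' RInf 𝓕 P

/-- The space `L^∞_t = L^∞(Ω, 𝓕_t, P)` (measurable versions). -/
def LInf (𝓕 : Filtration ℕ m) (P : Measure Ω) (t : ℕ) : Set (Ω → ℝ) :=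
  {Y | Measurable[𝓕 t] Y ∧ ∃ C : ℝ, ∀ᵐ ω ∂P, |Y ω| ≤ C}

/-! ### Risk measures for processes -/

/-- A conditional convex risk measure for processes `ρ_t : 𝓡_t^∞ → L^∞_t`. (Monotonicity makes
`ρ_t` compatible with `P`-a.s. equality.) -/
structure IsCondConvexRiskMeasure (𝓕 : Filtration ℕ m) (P : Measure Ω) (t : ℕ)
    (ρ : (ℕ∞ → Ω → ℝ) → Ω → ℝ) : Prop where
  mapsTo : ∀ X ∈ RInfFrom 𝓕 P t, ρ X ∈ LInf 𝓕 P t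
  cash_invariance : ∀ X ∈ RInfFrom 𝓕 P t, ∀ c ∈ LInf 𝓕 P t,
    ρ (fun r ω => X r ω + if (t : ℕ∞) ≤ r then c ω else 0) =ᵐ[P] fun ω => ρ X ω - c ω
  monotonicity : ∀ X ∈ RInfFrom 𝓕 P t, ∀ Y ∈ RInfFrom 𝓕 P t,
    (∀ r, X r ≤ᵐ[P] Y r) → ρ Y ≤ᵐ[P] ρ X
  convexity : ∀ X ∈ RInfFrom 𝓕 P t, ∀ Y ∈ RInfFrom 𝓕 P t, ∀ l ∈ LInf 𝓕 P t,
    (∀ ω, 0 ≤ l ω ∧ l ω ≤ 1) →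
    ρ (fun r ω => l ω * X r ω + (1 - l ω) * Y r ω)
      ≤ᵐ[P] fun ω => l ω * ρ X ω + (1 - l ω) * ρ Y ω
  normalization : ρ (fun _ _ => 0) =ᵐ[P] fun _ => 0

/-- A dynamic convex risk measure for processes `(ρ_t)`, `t ∈ ℕ`. -/
def IsDynConvexRiskMeasure (𝓕 : Filtration ℕ m) (P : Measure Ω)
    (ρ : ℕ → (ℕ∞ → Ω → ℝ) → Ω → ℝ) : Prop :=
  ∀ t, IsCondConvexRiskMeasure 𝓕 P t (ρ t)

/-- Continuity from above of `ρ_t`, where `ρ_t(X)` means `ρ_t(π_{t,∞}(X))` for `X ∈ 𝓡^∞`. -/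
def ContinuousFromAbove (𝓕 : Filtration ℕ m) (P : Measure Ω) (t : ℕ)
    (ρ : (ℕ∞ → Ω → ℝ) → Ω → ℝ) : Prop :=
  ∀ (X : ℕ → ℕ∞ → Ω → ℝ) (Y : ℕ∞ → Ω → ℝ), (∀ n, X n ∈ RInf 𝓕 P) → Y ∈ RInf 𝓕 P →
    (∀ s : ℕ∞, (t : ℕ∞) ≤ s → ∀ᵐ ω ∂P,
      Antitone (fun n => X n s ω) ∧ Tendsto (fun n => X n s ω) atTop (𝓝 (Y s ω))) →
    ∀ᵐ ω ∂P, Monotone (fun n => ρ (proj t (X n)) ω) ∧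
      Tendsto (fun n => ρ (proj t (X n)) ω) atTop (𝓝 (ρ (proj t Y) ω))

/-- (Strong) time consistency of a dynamic convex risk measure for processes. -/
def TimeConsistent (𝓕 : Filtration ℕ m) (P : Measure Ω)
    (ρ : ℕ → (ℕ∞ → Ω → ℝ) → Ω → ℝ) : Prop :=
  ∀ t : ℕ, ∀ X ∈ RInf 𝓕 P, ∀ Y ∈ RInf 𝓕 P,
    X t =ᵐ[P] Y t → ρ (t + 1) (proj (t + 1) X) ≤ᵐ[P] ρ (t + 1) (proj (t + 1) Y) →
    ρ t (proj t X) ≤ᵐ[P] ρ t (proj t Y)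

/-- The acceptance set `𝓐_t ⊆ 𝓡_t^∞` of `ρ_t`. -/
def acceptanceSet (𝓕 : Filtration ℕ m) (P : Measure Ω) (t : ℕ)
    (ρ : (ℕ∞ → Ω → ℝ) → Ω → ℝ) : Set (ℕ∞ → Ω → ℝ) :=
  {X ∈ RInfFrom 𝓕 P t | ρ X ≤ᵐ[P] fun _ => 0}

/-! ### Models `Q ⊗ D` -/

/-- The density `M_n` of `Q` with respect to `P` on `𝓕_n`. -/
def densityProcess (𝓕 : Filtration ℕ m) (P Q : Measure Ω) (n : ℕ) : Ω → ℝ≥0∞ :=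
  (Q.trim (𝓕.le n)).rnDeriv (P.trim (𝓕.le n))

/-- A version of `M_∞ = lim M_n`, with values in `[0, ∞]`; the limit exists `P`- and `Q`-a.s. -/
def densityLimit (𝓕 : Filtration ℕ m) (P Q : Measure Ω) : Ω → ℝ≥0∞ :=
  fun ω => limsup (fun n => densityProcess 𝓕 P Q n ω) atTop

/-- `D` is a predictable discounting process, `D ∈ 𝓓(Q)`, for the time set `ℕ ∪ {∞}`. -/
structure IsDiscounting (𝓕 : Filtration ℕ m) (P Q : Measure Ω) (D : ℕ∞ → Ω → ℝ) : Prop where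
  measurable_zero : Measurable[𝓕 0] (D 0)
  predictable : ∀ n : ℕ, Measurable[𝓕 n] (D (n + 1 : ℕ))
  measurable_top : Measurable[sigmaAt 𝓕 ⊤] (D ⊤)
  zero : ∀ᵐ ω ∂Q, D 0 ω = 1
  antitone : ∀ᵐ ω ∂Q, Antitone fun n : ℕ => D n ω
  tendsto : ∀ᵐ ω ∂Q, Tendsto (fun n : ℕ => D n ω) atTop (𝓝 (D ⊤ ω))
  nonneg : ∀ᵐ ω ∂Q, 0 ≤ D ⊤ ω
  singular : ∀ᵐ ω ∂Q, densityLimit 𝓕 P Q ω = ∞ → D ⊤ ω = 0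

/-- `(Q, D)` represents a model `Q ⊗ D`: `Q` is a probability measure, locally absolutely
continuous with respect to `P`, and `D ∈ 𝓓(Q)`. -/
structure IsModel (𝓕 : Filtration ℕ m) (P Q : Measure Ω) (D : ℕ∞ → Ω → ℝ) : Prop where
  isProbabilityMeasure : IsProbabilityMeasure Q
  locallyAbsolutelyContinuous : ∀ n, Q.trim (𝓕.le n) ≪ P.trim (𝓕.le n)
  isDiscounting : IsDiscounting 𝓕 P Q D

/-- The optional random measure `γ` associated with `D`: `γ_t = D_t - D_{t+1}` for `t ∈ ℕ`, and
`γ_∞ = D_∞`. -/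
def weight (D : ℕ∞ → Ω → ℝ) : ℕ∞ → Ω → ℝ
  | ⊤ => D ⊤
  | (n : ℕ) => fun ω => D n ω - D (n + 1 : ℕ) ω

/-- The optional `σ`-field on `Ω × (ℕ ∪ {∞})`, generated by the sets `A × {t}` with `A ∈ 𝓕_t`. -/
@[reducible] def optionalSigma (𝓕 : Filtration ℕ m) : MeasurableSpace (Ω × ℕ∞) :=
  MeasurableSpace.generateFrom
    {B | ∃ (t : ℕ∞) (A : Set Ω), MeasurableSet[sigmaAt 𝓕 t] A ∧ B = A ×ˢ {t}}

theorem measurable_section (𝓕 : Filtration ℕ m) (t : ℕ∞) :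
    Measurable[m, optionalSigma 𝓕] fun ω : Ω => (ω, t) := by
  refine measurable_generateFrom ?_
  rintro _ ⟨s, A, hA, rfl⟩
  by_cases h : t = s
  · have : (fun ω : Ω => (ω, t)) ⁻¹' (A ×ˢ {s}) = A := by ext; simp [h]
    rw [this]
    exact sigmaAt_le 𝓕 s _ hA
  · have : (fun ω : Ω => (ω, t)) ⁻¹' (A ×ˢ {s}) = ∅ := by ext; simp [h]
    rw [this]
    exact MeasurableSet.empty

/-- The measure `Q ⊗ D = Q ⊗ γ` on the optional `σ`-field, that is
`E_{Q ⊗ D}[X] = E_Q[∑_{t ∈ ℕ ∪ {∞}} γ_t X_t]`. -/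
def productMeasure (𝓕 : Filtration ℕ m) (Q : Measure Ω) (D : ℕ∞ → Ω → ℝ) :
    Measure[optionalSigma 𝓕] (Ω × ℕ∞) :=
  Measure.sum fun t : ℕ∞ =>
    @Measure.map Ω (Ω × ℕ∞) m (optionalSigma 𝓕) (fun ω => (ω, t))
      (Q.withDensity fun ω => ENNReal.ofReal (weight D t ω))

/-! ### Penalties, bubbles and asymptotic safety -/

/-- `∑_{s ≥ t} γ_s X_s / D_t`, the sum including `s = ∞`. -/
def discountedSum (D : ℕ∞ → Ω → ℝ) (t : ℕ) (X : ℕ∞ → Ω → ℝ) : Ω → ℝ := fun ω =>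
  (∑' k : ℕ, weight D (t + k : ℕ) ω / D t ω * X (t + k : ℕ) ω) + weight D ⊤ ω / D t ω * X ⊤ ω

open Classical in
/-- The minimal penalty `α_t(Q ⊗ D)`: on `{D_t > 0}` it is the `Q`-essential supremum over
`X ∈ 𝓐_t` of `E_Q[-∑_{s ≥ t} (γ_s / D_t) X_s | 𝓕_t]`, and it is `∞` on `{D_t = 0}`. -/
def penalty (𝓕 : Filtration ℕ m) (P : Measure Ω) (ρ : ℕ → (ℕ∞ → Ω → ℝ) → Ω → ℝ)
    (Q : Measure Ω) (D : ℕ∞ → Ω → ℝ) (t : ℕ) : Ω → EReal := fun ω =>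
  if 0 < D t ω then
    essSupFamily (𝓕 t) Q
      ((fun X ω' => ((Q[fun ω'' => - discountedSum D t X ω'' | 𝓕 t] ω' : ℝ) : EReal)) ''
        acceptanceSet 𝓕 P t (ρ t)) ω
  else ⊤

/-- The discounted penalty process `D_t α_t(Q ⊗ D) ∈ [0, ∞]`, with `0 · ∞ = 0`. (The penalty is
nonnegative because `0` is acceptable.) -/
def discountedPenalty (𝓕 : Filtration ℕ m) (P : Measure Ω) (ρ : ℕ → (ℕ∞ → Ω → ℝ) → Ω → ℝ)
    (Q : Measure Ω) (D : ℕ∞ → Ω → ℝ) (t : ℕ) : Ω → ℝ≥0∞ := fun ω =>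
  ENNReal.ofReal (D t ω) * (penalty 𝓕 P ρ Q D t ω).toENNReal

/-- The initial penalty `α_0(Q ⊗ D)` is finite. -/
def FinitePenalty (𝓕 : Filtration ℕ m) (P : Measure Ω) (ρ : ℕ → (ℕ∞ → Ω → ℝ) → Ω → ℝ)
    (Q : Measure Ω) (D : ℕ∞ → Ω → ℝ) : Prop :=
  ∀ᵐ ω ∂Q, penalty 𝓕 P ρ Q D 0 ω < ⊤

/-- The bubble `N_t^{Q,D} = lim_{s → ∞} E_Q[D_s α_s(Q ⊗ D) | 𝓕_t]`, the martingale part of the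
Riesz decomposition of the discounted penalty process. If `α_0(Q ⊗ D) < ∞` the sequence is
`Q`-a.s. decreasing for `s ≥ t`; if the upper limit vanishes then the limit exists. -/
def bubble (𝓕 : Filtration ℕ m) (P : Measure Ω) (ρ : ℕ → (ℕ∞ → Ω → ℝ) → Ω → ℝ)
    (Q : Measure Ω) (D : ℕ∞ → Ω → ℝ) (t : ℕ) : Ω → ℝ≥0∞ := fun ω =>
  limsup (fun s : ℕ => (Q⁻[discountedPenalty 𝓕 P ρ Q D s | 𝓕 t]) ω) atTop

/-- The model `Q ⊗ D` has no bubble. -/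
def NoBubble (𝓕 : Filtration ℕ m) (P : Measure Ω) (ρ : ℕ → (ℕ∞ → Ω → ℝ) → Ω → ℝ)
    (Q : Measure Ω) (D : ℕ∞ → Ω → ℝ) : Prop :=
  ∀ t : ℕ, bubble 𝓕 P ρ Q D t =ᵐ[Q] 0

/-- A nonnegative process `Z` is a `Q`-potential: an integrable supermartingale whose expectations
tend to zero. -/
structure IsPotential (𝓕 : Filtration ℕ m) (Q : Measure Ω) (Z : ℕ → Ω → ℝ≥0∞) : Prop where
  adapted : ∀ t, Measurable[𝓕 t] (Z t)
  integrable : ∀ t, ∫⁻ ω, Z t ω ∂Q ≠ ∞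
  supermartingale : ∀ s t, s ≤ t → Q⁻[Z t | 𝓕 s] ≤ᵐ[Q] Z s
  tendsto_zero : Tendsto (fun t => ∫⁻ ω, Z t ω ∂Q) atTop (𝓝 0)

/-- The limiting capital requirement `ρ_∞(X) = lim_{t → ∞} ρ_t(X)`. -/
def limitRisk (ρ : ℕ → (ℕ∞ → Ω → ℝ) → Ω → ℝ) (X : ℕ∞ → Ω → ℝ) : Ω → ℝ := fun ω =>
  limUnder atTop fun t : ℕ => ρ t (proj t X) ω

/-- `(ρ_t)` is asymptotically safe under `Q ⊗ D`: `ρ_∞(X) ≥ -X_∞` `Q`-a.s. on `{D_∞ > 0}` for all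
`X ∈ 𝓡^∞`. -/
def AsymptoticallySafe (𝓕 : Filtration ℕ m) (P : Measure Ω)
    (ρ : ℕ → (ℕ∞ → Ω → ℝ) → Ω → ℝ) (Q : Measure Ω) (D : ℕ∞ → Ω → ℝ) : Prop :=
  ∀ X ∈ RInf 𝓕 P, ∀ᵐ ω ∂Q, 0 < D ⊤ ω → -X ⊤ ω ≤ limitRisk ρ X ω

end RiskProcess

end

noncomputable section

namespace RiskProcess

section

variable {Ω : Type*} {m : MeasurableSpace Ω} {𝓕 : Filtration ℕ m} {P : Measure Ω}

/-! ### Bounded adapted processes -/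

/-! Write W_t = D_t α_t for the discounted penalty and w_t = E_Q[W_t].

Everything rests on one supermartingale: for each bounded X, the process V_t = W_t + D_t ρ_t(X) -
∑_{r<t} γ_r X_r is a Q-supermartingale. By time consistency, a position that follows X up to t, is
then replaced by an acceptable Y minus the cash ρ_t(X), and receives ρ_s(X) at time s, is acceptable
at s (`paste_mem_acceptanceSet`). Its loss is bounded by W_s. Since W_t is an increasing limit of
conditional losses of such Y (`IsModel.exists_seq_discountedPenalty`), monotone convergence gives
`IsModel.setLIntegral_discountedPenalty_add_le`. The case X = 0 says that W itself is a
supermartingale. Both V and W are bounded in L¹, hence converge; subtracting them, D_t ρ_t(X)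
converges, and so does ρ_t(X) on {D_∞ > 0}.

Potential implies safety: X + ρ_t(X) is acceptable, so E_Q[-∑_{s≥t} γ_s X_s | 𝓕_t] ≤ D_t ρ_t(X) +
W_t. For a potential W_t → 0 a.s., while the left side is bounded below by processes tending to -D_∞
X_∞; divide by D_∞.

Safety implies potential: for X acceptable at time 0 the supermartingale inequality bounds w_t plus
the expected running cost of X by w_0. Under safety the running cost has a limit at least as large
as the total discounted loss of X, so lim w_t + E_Q[-∑ γ_s X_s] ≤ w_0. The supremum over acceptable
X gives lim w_t + w_0 ≤ w_0, and w_0 is finite.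

Triviality of 𝓕_0 identifies absence of a bubble with w_t → 0. Safety is a statement about an
𝓕_∞-event on the slice at time ∞, so it passes to every absolutely continuous model, to which the
previous implication then applies.

Since Q is only locally dominated by P, P-null events of 𝓕_∞ need care: they are Q-null on {M_∞ <
∞}, which contains {D_∞ > 0} up to a Q-null set. -/

theorem filtration_le_sigmaAt (𝓕 : Filtration ℕ m) {t : ℕ} {r : ℕ∞} (h : (t : ℕ∞) ≤ r) :
    𝓕 t ≤ sigmaAt 𝓕 r := by
  cases r with
  | top => exact le_iSup (fun n => 𝓕 n) t
  | coe n => exact 𝓕.mono (by exact_mod_cast h)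

theorem proj_apply_of_le {t : ℕ} {r : ℕ∞} (h : (t : ℕ∞) ≤ r) (X : ℕ∞ → Ω → ℝ) :
    proj t X r = X r := by
  funext ω; simp [proj, h]

theorem proj_apply_of_not_le {t : ℕ} {r : ℕ∞} (h : ¬ (t : ℕ∞) ≤ r) (X : ℕ∞ → Ω → ℝ) :
    proj t X r = 0 := by
  funext ω; simp [proj, h]

theorem proj_mem_RInf {X : ℕ∞ → Ω → ℝ} (hX : X ∈ RInf 𝓕 P) (t : ℕ) : proj t X ∈ RInf 𝓕 P := by
  obtain ⟨hm, C, hC⟩ := hX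
  refine ⟨fun r => ?_, max C 0, fun r => ?_⟩ <;> by_cases h : (t : ℕ∞) ≤ r
  · rw [proj_apply_of_le h]; exact hm r
  · rw [proj_apply_of_not_le h]; exact measurable_const
  · rw [proj_apply_of_le h]
    filter_upwards [hC r] with ω hω using hω.trans (le_max_left _ _)
  · rw [proj_apply_of_not_le h]
    exact Eventually.of_forall fun ω => by simp

theorem proj_mem_RInfFrom {X : ℕ∞ → Ω → ℝ} (hX : X ∈ RInf 𝓕 P) (t : ℕ) :
    proj t X ∈ RInfFrom 𝓕 P t := ⟨X, hX, rfl⟩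

theorem proj_proj (t : ℕ) (X : ℕ∞ → Ω → ℝ) : proj t (proj t X) = proj t X := by
  funext r ω; simp only [proj]; split_ifs <;> rfl

theorem proj_eq_self {t : ℕ} {X : ℕ∞ → Ω → ℝ} (hX : X ∈ RInfFrom 𝓕 P t) : proj t X = X := by
  obtain ⟨Y, -, rfl⟩ := hX
  exact proj_proj t Y

theorem RInfFrom_subset {t : ℕ} {X : ℕ∞ → Ω → ℝ} (hX : X ∈ RInfFrom 𝓕 P t) : X ∈ RInf 𝓕 P := by
  obtain ⟨Y, hY, rfl⟩ := hX
  exact proj_mem_RInf hY t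

theorem exists_bound {X : ℕ∞ → Ω → ℝ} (hX : X ∈ RInf 𝓕 P) :
    ∃ C : ℝ, 0 ≤ C ∧ ∀ t, ∀ᵐ ω ∂P, |X t ω| ≤ C := by
  obtain ⟨-, C, hC⟩ := hX
  exact ⟨max C 0, le_max_right _ _, fun t => (hC t).mono fun ω h => h.trans (le_max_left _ _)⟩

theorem add_mem_RInf {X Y : ℕ∞ → Ω → ℝ} (hX : X ∈ RInf 𝓕 P) (hY : Y ∈ RInf 𝓕 P) :
    (fun r ω => X r ω + Y r ω) ∈ RInf 𝓕 P := by
  obtain ⟨hXm, C, hC⟩ := hX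
  obtain ⟨hYm, C', hC'⟩ := hY
  refine ⟨fun r => (hXm r).add (hYm r), C + C', fun r => ?_⟩
  filter_upwards [hC r, hC' r] with ω h1 h2 using (abs_add_le _ _).trans (add_le_add h1 h2)

/-- The process that pays the `𝓕_t`-measurable amount `c` at each time from `t` on. -/
def cash (t : ℕ) (c : Ω → ℝ) : ℕ∞ → Ω → ℝ := fun r ω => if (t : ℕ∞) ≤ r then c ω else 0

theorem cash_mem_RInf {t : ℕ} {c : Ω → ℝ} (hc : c ∈ LInf 𝓕 P t) : cash t c ∈ RInf 𝓕 P := by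
  obtain ⟨hm, C, hC⟩ := hc
  refine ⟨fun r => ?_, max C 0, fun r => ?_⟩ <;> by_cases h : (t : ℕ∞) ≤ r
  · have : cash t c r = c := by funext ω; simp [cash, h]
    rw [this]; exact hm.mono (filtration_le_sigmaAt 𝓕 h) le_rfl
  · have : cash t c r = fun _ => 0 := by funext ω; simp [cash, h]
    rw [this]; exact measurable_const
  · filter_upwards [hC] with ω hω
    simpa [cash, h] using Or.inl hω
  · exact Eventually.of_forall fun ω => by simp [cash, h]

theorem neg_mem_LInf {t : ℕ} {c : Ω → ℝ} (hc : c ∈ LInf 𝓕 P t) :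
    (fun ω => -c ω) ∈ LInf 𝓕 P t := by
  obtain ⟨hm, C, hC⟩ := hc
  exact ⟨hm.neg, C, by simpa using hC⟩

theorem const_mem_LInf (t : ℕ) (c : ℝ) : (fun _ => c) ∈ LInf 𝓕 P t :=
  ⟨measurable_const, |c|, Eventually.of_forall fun _ => le_rfl⟩

theorem zero_mem_RInf : (fun _ _ => 0 : ℕ∞ → Ω → ℝ) ∈ RInf 𝓕 P :=
  ⟨fun _ => measurable_const, 0, fun _ => Eventually.of_forall fun _ => by simp⟩

/-- The process that follows `X` before time `t` and `Y` from time `t` on. -/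
def paste (t : ℕ) (X Y : ℕ∞ → Ω → ℝ) : ℕ∞ → Ω → ℝ :=
  fun r ω => if (t : ℕ∞) ≤ r then Y r ω else X r ω

theorem paste_mem_RInf {X Y : ℕ∞ → Ω → ℝ} (hX : X ∈ RInf 𝓕 P) (hY : Y ∈ RInf 𝓕 P) (t : ℕ) :
    paste t X Y ∈ RInf 𝓕 P := by
  obtain ⟨hXm, C, hC⟩ := hX
  obtain ⟨hYm, C', hC'⟩ := hY
  refine ⟨fun r => ?_, max C C', fun r => ?_⟩ <;> by_cases h : (t : ℕ∞) ≤ r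
  · have : paste t X Y r = Y r := by funext ω; simp [paste, h]
    rw [this]; exact hYm r
  · have : paste t X Y r = X r := by funext ω; simp [paste, h]
    rw [this]; exact hXm r
  · filter_upwards [hC' r] with ω hω
    simpa [paste, h] using Or.inr hω
  · filter_upwards [hC r] with ω hω
    simpa [paste, h] using Or.inl hω

theorem proj_paste (t : ℕ) (X Y : ℕ∞ → Ω → ℝ) : proj t (paste t X Y) = proj t Y := by
  funext r ω; simp only [proj, paste]; split_ifs <;> rfl

/-! ### Consequences of the axioms of a risk measure -/

section RiskMeasure

variable {ρ : (ℕ∞ → Ω → ℝ) → Ω → ℝ} {t : ℕ}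

theorem IsCondConvexRiskMeasure.risk_mem (h : IsCondConvexRiskMeasure 𝓕 P t ρ)
    {X : ℕ∞ → Ω → ℝ} (hX : X ∈ RInf 𝓕 P) : ρ (proj t X) ∈ LInf 𝓕 P t :=
  h.mapsTo _ (proj_mem_RInfFrom hX t)

theorem IsCondConvexRiskMeasure.mono_of_le (h : IsCondConvexRiskMeasure 𝓕 P t ρ)
    {X Y : ℕ∞ → Ω → ℝ} (hX : X ∈ RInf 𝓕 P) (hY : Y ∈ RInf 𝓕 P)
    (hXY : ∀ r : ℕ∞, (t : ℕ∞) ≤ r → X r ≤ᵐ[P] Y r) : ρ (proj t Y) ≤ᵐ[P] ρ (proj t X) := by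
  refine h.monotonicity _ (proj_mem_RInfFrom hX t) _ (proj_mem_RInfFrom hY t) fun r => ?_
  by_cases hr : (t : ℕ∞) ≤ r
  · rw [proj_apply_of_le hr, proj_apply_of_le hr]; exact hXY r hr
  · rw [proj_apply_of_not_le hr, proj_apply_of_not_le hr]

theorem IsCondConvexRiskMeasure.risk_zero (h : IsCondConvexRiskMeasure 𝓕 P t ρ) :
    ρ (proj t fun _ _ => 0) =ᵐ[P] fun _ => 0 := by
  have : (proj t fun _ _ => 0 : ℕ∞ → Ω → ℝ) = fun _ _ => 0 := by
    funext r ω; simp [proj]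
  rw [this]; exact h.normalization

theorem IsCondConvexRiskMeasure.risk_add_cash (h : IsCondConvexRiskMeasure 𝓕 P t ρ)
    {X : ℕ∞ → Ω → ℝ} (hX : X ∈ RInf 𝓕 P) {c : Ω → ℝ} (hc : c ∈ LInf 𝓕 P t) :
    ρ (proj t fun r ω => X r ω + cash t c r ω) =ᵐ[P] fun ω => ρ (proj t X) ω - c ω := by
  have := h.cash_invariance _ (proj_mem_RInfFrom hX t) c hc
  convert this using 2
  funext r ω
  simp only [proj, cash]; split_ifs <;> simp

/-- Sandwich X between the constant positions -C and C, whose risks are C and -C by normalization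
and cash invariance. -/
theorem IsCondConvexRiskMeasure.abs_risk_le (h : IsCondConvexRiskMeasure 𝓕 P t ρ)
    {X : ℕ∞ → Ω → ℝ} (hX : X ∈ RInf 𝓕 P) {C : ℝ} (hC : ∀ r, ∀ᵐ ω ∂P, |X r ω| ≤ C) :
    ∀ᵐ ω ∂P, |ρ (proj t X) ω| ≤ C := by
  have hc : ∀ c : ℝ, ρ (proj t fun r ω => 0 + cash t (fun _ => c) r ω) =ᵐ[P] fun ω => -c := by
    intro c
    filter_upwards [h.risk_add_cash zero_mem_RInf (const_mem_LInf t c), h.risk_zero] with ω h1 h2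
    rw [h1, h2, zero_sub]
  have hmem : ∀ c : ℝ, (fun r ω => 0 + cash t (fun _ : Ω => c) r ω) ∈ RInf 𝓕 P := fun c =>
    add_mem_RInf zero_mem_RInf (cash_mem_RInf (const_mem_LInf t c))
  have h1 := h.mono_of_le hX (hmem C) fun r hr => by
    filter_upwards [hC r] with ω hω
    simpa [cash, hr] using (abs_le.1 hω).2
  have h2 := h.mono_of_le (hmem (-C)) hX fun r hr => by
    filter_upwards [hC r] with ω hω
    simpa [cash, hr] using (abs_le.1 hω).1
  filter_upwards [h1, h2, hc C, hc (-C)] with ω a1 a2 a3 a4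
  rw [a3] at a1
  rw [a4] at a2
  exact abs_le.2 ⟨a1, by simpa using a2⟩

/-- The capital requirement makes a position acceptable. -/
theorem IsCondConvexRiskMeasure.add_risk_mem_acceptanceSet (h : IsCondConvexRiskMeasure 𝓕 P t ρ)
    {X : ℕ∞ → Ω → ℝ} (hX : X ∈ RInf 𝓕 P) {c : Ω → ℝ} (hc : c ∈ LInf 𝓕 P t)
    (hle : ρ (proj t X) ≤ᵐ[P] c) :
    (proj t fun r ω => X r ω + cash t c r ω) ∈ acceptanceSet 𝓕 P t ρ := by
  refine ⟨proj_mem_RInfFrom (add_mem_RInf hX (cash_mem_RInf hc)) t, ?_⟩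
  filter_upwards [h.risk_add_cash hX hc, hle] with ω h1 h2
  rw [h1]; exact sub_nonpos.2 h2

theorem IsCondConvexRiskMeasure.zero_mem_acceptanceSet (h : IsCondConvexRiskMeasure 𝓕 P t ρ) :
    (fun _ _ => 0) ∈ acceptanceSet 𝓕 P t ρ :=
  ⟨⟨_, zero_mem_RInf, by funext r ω; simp [proj]⟩, h.normalization.le⟩

/-- Acceptance sets are stable under splitting along an `𝓕_t`-measurable event. -/
theorem IsCondConvexRiskMeasure.piecewise_mem_acceptanceSet
    (h : IsCondConvexRiskMeasure 𝓕 P t ρ) {X Y : ℕ∞ → Ω → ℝ} (hX : X ∈ acceptanceSet 𝓕 P t ρ)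
    (hY : Y ∈ acceptanceSet 𝓕 P t ρ) {l : Ω → ℝ} (hl : Measurable[𝓕 t] l)
    (h01 : ∀ ω, 0 ≤ l ω ∧ l ω ≤ 1) :
    (fun r ω => l ω * X r ω + (1 - l ω) * Y r ω) ∈ acceptanceSet 𝓕 P t ρ := by
  have hlL : l ∈ LInf 𝓕 P t :=
    ⟨hl, 1, Eventually.of_forall fun ω => abs_le.2 ⟨by linarith [(h01 ω).1], (h01 ω).2⟩⟩
  refine ⟨⟨proj t fun r ω => l ω * X r ω + (1 - l ω) * Y r ω, ?_, ?_⟩, ?_⟩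
  · obtain ⟨hXm, C, hC⟩ := RInfFrom_subset hX.1
    obtain ⟨hYm, C', hC'⟩ := RInfFrom_subset hY.1
    refine ⟨fun r => ?_, max C C', fun r => ?_⟩ <;> by_cases hr : (t : ℕ∞) ≤ r
    · rw [proj_apply_of_le hr]
      have hl' := hl.mono (filtration_le_sigmaAt 𝓕 hr) le_rfl
      exact (hl'.mul (hXm r)).add ((measurable_const.sub hl').mul (hYm r))
    · rw [proj_apply_of_not_le hr]; exact measurable_const
    · rw [proj_apply_of_le hr]
      filter_upwards [hC r, hC' r] with ω h1 h2
      have := h01 ω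
      rw [abs_le] at *
      have := le_max_left C C'
      have := le_max_right C C'
      constructor <;> nlinarith
    · rw [proj_apply_of_not_le hr]
      filter_upwards [hC r] with ω h1
      simpa using Or.inl ((abs_nonneg _).trans h1)
  · rw [proj_proj]
    conv_rhs => rw [← proj_eq_self hX.1, ← proj_eq_self hY.1]
    funext r ω
    simp only [proj]; split_ifs <;> simp
  · filter_upwards [h.convexity X hX.1 Y hY.1 l hlL h01, hX.2, hY.2] with ω h1 h2 h3
    have := h01 ω
    refine h1.trans ?_
    have := mul_nonneg this.1 (neg_nonneg.2 h2)
    have := mul_nonneg (sub_nonneg.2 (h01 ω).2) (neg_nonneg.2 h3)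
    linarith

end RiskMeasure

/-! ### Consequences of time consistency -/

variable {ρ : ℕ → (ℕ∞ → Ω → ℝ) → Ω → ℝ}

/-- One-step time consistency is iterated backwards from t to s; agreement of the two positions
before t feeds each step. -/
theorem TimeConsistent.risk_le (htc : TimeConsistent 𝓕 P ρ) {X Y : ℕ∞ → Ω → ℝ}
    (hX : X ∈ RInf 𝓕 P) (hY : Y ∈ RInf 𝓕 P) {s t : ℕ} (hst : s ≤ t)
    (hXY : ∀ r : ℕ, r < t → X r =ᵐ[P] Y r)
    (hle : ρ t (proj t X) ≤ᵐ[P] ρ t (proj t Y)) :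
    ρ s (proj s X) ≤ᵐ[P] ρ s (proj s Y) := by
  induction t, hst using Nat.le_induction with
  | base => exact hle
  | succ t _ ih =>
    exact ih (fun r hr => hXY r (hr.trans t.lt_succ_self))
      (htc t X hX Y hY (hXY t t.lt_succ_self) hle)

/-- Following `X` up to time `t`, exchanging its continuation for its value `-ρ_t(X)` plus an
acceptable position, and adding the capital `ρ_s(X)` at time `s` is acceptable at time `s`. -/
theorem paste_mem_acceptanceSet (hρ : IsDynConvexRiskMeasure 𝓕 P ρ) (htc : TimeConsistent 𝓕 P ρ)
    {X Y : ℕ∞ → Ω → ℝ} (hX : X ∈ RInf 𝓕 P) {s t : ℕ} (hst : s ≤ t)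
    (hY : Y ∈ acceptanceSet 𝓕 P t (ρ t)) :
    (proj s fun r ω => paste t X (fun r ω => Y r ω + cash t (fun ω => -ρ t (proj t X) ω) r ω) r ω +
      cash s (ρ s (proj s X)) r ω) ∈ acceptanceSet 𝓕 P s (ρ s) := by
  have hYR := RInfFrom_subset hY.1
  have hc := neg_mem_LInf ((hρ t).risk_mem hX)
  have hZ : (fun r ω => Y r ω + cash t (fun ω => -ρ t (proj t X) ω) r ω) ∈ RInf 𝓕 P :=
    add_mem_RInf hYR (cash_mem_RInf hc)
  refine (hρ s).add_risk_mem_acceptanceSet (paste_mem_RInf hX hZ t) ((hρ s).risk_mem hX) ?_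
  -- It suffices to compare risks at time t: there the pasted position has risk ρ_t(Y) + ρ_t(X) ≤
  -- ρ_t(X).
  refine htc.risk_le (paste_mem_RInf hX hZ t) hX hst (fun r hr => ?_) ?_
  · refine Eventually.of_forall fun ω => ?_
    have : ¬ (t : ℕ∞) ≤ (r : ℕ∞) := by exact_mod_cast not_le.2 hr
    simp [paste, this]
  · rw [proj_paste]
    filter_upwards [(hρ t).risk_add_cash hYR hc, hY.2] with ω h1 h2
    rw [h1, proj_eq_self hY.1]
    linarith

end

section

variable {Ω : Type*} {m : MeasurableSpace Ω} {𝓕 : Filtration ℕ m} {P Q : Measure Ω}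
  {D : ℕ∞ → Ω → ℝ}

/-! ### Local and global absolute continuity -/

theorem measure_inter_densityProcess_le [IsFiniteMeasure P] [IsFiniteMeasure Q] {n : ℕ}
    (hac : Q.trim (𝓕.le n) ≪ P.trim (𝓕.le n)) {A : Set Ω} (hA : MeasurableSet[𝓕 n] A)
    (K : ℝ≥0∞) : Q (A ∩ {ω | densityProcess 𝓕 P Q n ω ≤ K}) ≤ K * P A := by
  have hM : Measurable[𝓕 n] (densityProcess 𝓕 P Q n) := Measure.measurable_rnDeriv _ _
  have hB : MeasurableSet[𝓕 n] (A ∩ {ω | densityProcess 𝓕 P Q n ω ≤ K}) :=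
    MeasurableSet.inter hA (@measurableSet_le _ _ _ _ _ (𝓕 n) _ _ _ _ _ hM measurable_const)
  rw [← trim_measurableSet_eq (𝓕.le n) hB, ← Measure.setLIntegral_rnDeriv' hac hB]
  calc ∫⁻ ω in A ∩ {ω | densityProcess 𝓕 P Q n ω ≤ K},
        (Q.trim (𝓕.le n)).rnDeriv (P.trim (𝓕.le n)) ω ∂P.trim (𝓕.le n)
      ≤ ∫⁻ _ in A ∩ {ω | densityProcess 𝓕 P Q n ω ≤ K}, K ∂P.trim (𝓕.le n) :=
        setLIntegral_mono measurable_const fun ω hω => hω.2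
    _ = K * P (A ∩ {ω | densityProcess 𝓕 P Q n ω ≤ K}) := by
        rw [setLIntegral_const, trim_measurableSet_eq (𝓕.le n) hB]
    _ ≤ K * P A := by gcongr; exact inter_subset_left

/-- A measure that is dominated by a multiple of `P` on `𝓕_n` for all large `n` is absolutely
continuous with respect to `P` on `𝓕_∞`. -/
theorem measure_eq_zero_of_eventually_le_mul {ν : Measure Ω} [IsFiniteMeasure P]
    [IsFiniteMeasure ν] {K : ℝ≥0∞} (hK : K ≠ ∞)
    (hν : ∀ᶠ n in atTop, ∀ A, MeasurableSet[𝓕 n] A → ν A ≤ K * P A)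
    {A : Set Ω} (hA : MeasurableSet[⨆ n, 𝓕 n] A) (hPA : P A = 0) : ν A = 0 := by
  have hle : ⨆ n, 𝓕 n ≤ m := iSup_le 𝓕.le
  have hAm : MeasurableSet A := hle _ hA
  -- Lévy's upward theorem under P + ν makes the 𝓕_n-events B_n (conditional probability of A above
  -- 1/2) converge to A both P-a.s. and ν-a.s., so the domination on 𝓕_n passes to A.
  set h : ℕ → Ω → ℝ := fun n => (P + ν)[A.indicator fun _ => (1 : ℝ) | 𝓕 n] with hh
  set B : ℕ → Set Ω := fun n => {ω | 1 / 2 < h n ω} with hB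
  have hhm : ∀ n, Measurable[𝓕 n] (h n) := fun n => stronglyMeasurable_condExp.measurable
  have hBm : ∀ n, MeasurableSet[𝓕 n] (B n) := fun n =>
    @measurableSet_lt _ _ _ _ _ (𝓕 n) _ _ _ _ _ measurable_const (hhm n)
  have hlim : ∀ᵐ ω ∂(P + ν), ∀ᶠ n in atTop, ω ∈ B n ↔ ω ∈ A := by
    have hself : (P + ν)[A.indicator fun _ => (1 : ℝ) | ⨆ n, 𝓕 n] = A.indicator fun _ => (1 : ℝ) :=
      condExp_of_stronglyMeasurable hle
        ((@measurable_const _ _ _ (⨆ n, 𝓕 n) (1 : ℝ)).indicator hA).stronglyMeasurable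
        ((integrable_const _).indicator hAm)
    filter_upwards [tendsto_ae_condExp (ℱ := 𝓕) (μ := P + ν) (A.indicator fun _ => (1 : ℝ))]
      with ω hω
    rw [hself] at hω
    by_cases hωA : ω ∈ A
    · rw [indicator_of_mem hωA] at hω
      filter_upwards [hω.eventually (lt_mem_nhds (show (1 / 2 : ℝ) < 1 by norm_num))] with n hn
      exact ⟨fun _ => hωA, fun _ => hn⟩
    · rw [indicator_of_notMem hωA] at hω
      filter_upwards [hω.eventually (gt_mem_nhds (show (0 : ℝ) < 1 / 2 by norm_num))] with n hn
      exact ⟨fun h' => absurd hn (not_lt.2 (le_of_lt h')), fun h' => absurd h' hωA⟩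
  rw [ae_add_measure_iff] at hlim
  have hP := tendsto_measure_of_ae_tendsto_indicator_of_isFiniteMeasure atTop hAm
    (fun n => 𝓕.le n _ (hBm n)) hlim.1
  have hN := tendsto_measure_of_ae_tendsto_indicator_of_isFiniteMeasure atTop hAm
    (fun n => 𝓕.le n _ (hBm n)) hlim.2
  have hKP := ENNReal.Tendsto.const_mul hP (Or.inr hK)
  rw [hPA, mul_zero] at hKP
  exact le_antisymm (le_of_tendsto_of_tendsto hN hKP
    (hν.mono fun n hn => hn _ (hBm n))) zero_le

theorem measurable_densityProcess (𝓕 : Filtration ℕ m) (P Q : Measure Ω) (n : ℕ) :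
    Measurable (densityProcess 𝓕 P Q n) :=
  (Measure.measurable_rnDeriv _ _).mono (𝓕.le n) le_rfl

/-- On `{M_∞ < ∞}` the measure `Q` is absolutely continuous with respect to `P` on `𝓕_∞`. -/
theorem ae_densityLimit_eq_top [IsFiniteMeasure P] [IsFiniteMeasure Q]
    (hac : ∀ n, Q.trim (𝓕.le n) ≪ P.trim (𝓕.le n)) {A : Set Ω}
    (hA : MeasurableSet[⨆ n, 𝓕 n] A) (hPA : P A = 0) :
    ∀ᵐ ω ∂Q, ω ∈ A → densityLimit 𝓕 P Q ω = ∞ := by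
  have hAm : MeasurableSet A := (iSup_le 𝓕.le : ⨆ n, 𝓕 n ≤ m) _ hA
  -- Restricted to the event that M_n ≤ K for all n ≥ N, Q is dominated by K·P on 𝓕_n for n ≥ N.
  -- Countably many such events cover {M_∞ < ∞}.
  have key : ∀ K N : ℕ, ∀ᵐ ω ∂Q, ¬ (ω ∈ A ∧ ∀ n, N ≤ n → densityProcess 𝓕 P Q n ω ≤ K) := by
    intro K N
    set B : Set Ω := {ω | ∀ n, N ≤ n → densityProcess 𝓕 P Q n ω ≤ K}
    have hB : MeasurableSet B := by
      have : B = ⋂ n, ⋂ (_ : N ≤ n), {ω | densityProcess 𝓕 P Q n ω ≤ K} := by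
        ext ω; simp [B]
      rw [this]
      exact MeasurableSet.iInter fun n => MeasurableSet.iInter fun _ =>
        measurableSet_le (measurable_densityProcess 𝓕 P Q n) measurable_const
    have h0 : (Q.restrict B) A = 0 := by
      refine measure_eq_zero_of_eventually_le_mul (𝓕 := 𝓕) (P := P) (K := K)
        (ENNReal.natCast_ne_top K) ?_ hA hPA
      filter_upwards [eventually_ge_atTop N] with n hn C hC
      rw [Measure.restrict_apply (𝓕.le n _ hC)]
      refine (measure_mono ?_).trans (measure_inter_densityProcess_le (hac n) hC K)
      exact fun ω hω => ⟨hω.1, hω.2 n hn⟩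
    rw [Measure.restrict_apply hAm] at h0
    rw [ae_iff]
    convert h0 using 2
    ext ω; simp [B]
  filter_upwards [ae_all_iff.2 fun K => ae_all_iff.2 (key K)] with ω hω hωA
  by_contra hne
  obtain ⟨K, hK⟩ := ENNReal.exists_nat_gt hne
  obtain ⟨N, hN⟩ := eventually_atTop.1 (eventually_lt_of_limsup_lt hK)
  exact hω K N ⟨hωA, fun n hn => (hN n hn).le⟩

/-! ### Transfer of almost sure properties to a model -/

theorem IsModel.ae_of_ae (h : IsModel 𝓕 P Q D) {t : ℕ} {p : Ω → Prop}
    (hp : MeasurableSet[𝓕 t] {ω | p ω}) (hP : ∀ᵐ ω ∂P, p ω) : ∀ᵐ ω ∂Q, p ω := by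
  have h0 : P.trim (𝓕.le t) {ω | p ω}ᶜ = 0 := by
    rw [trim_measurableSet_eq (𝓕.le t) hp.compl]; exact hP
  have := h.locallyAbsolutelyContinuous t h0
  rwa [trim_measurableSet_eq (𝓕.le t) hp.compl] at this

/-- The singularity condition on D forces M_∞ < ∞ Q-a.s. on {D_∞ > 0}, and there P-null events of
𝓕_∞ are Q-null. -/
theorem IsModel.ae_of_ae_top [IsFiniteMeasure P] (h : IsModel 𝓕 P Q D) {p : Ω → Prop}
    (hp : MeasurableSet[⨆ n, 𝓕 n] {ω | p ω}) (hP : ∀ᵐ ω ∂P, p ω) :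
    ∀ᵐ ω ∂Q, 0 < D ⊤ ω → p ω := by
  have := h.isProbabilityMeasure
  filter_upwards [ae_densityLimit_eq_top h.locallyAbsolutelyContinuous hp.compl hP,
    h.isDiscounting.singular] with ω h1 h2 h3
  by_contra hn
  exact h3.ne' (h2 (h1 hn))

theorem IsModel.ae_abs_le (h : IsModel 𝓕 P Q D) {t : ℕ} {f : Ω → ℝ} (hf : Measurable[𝓕 t] f)
    {C : ℝ} (hC : ∀ᵐ ω ∂P, |f ω| ≤ C) : ∀ᵐ ω ∂Q, |f ω| ≤ C :=
  h.ae_of_ae (p := fun ω => |f ω| ≤ C)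
    (@measurableSet_le _ _ _ _ _ (𝓕 t) _ _ _ _ _ (_root_.measurable_abs.comp hf)
      measurable_const) hC

/-- `X` is bounded by `C` along the path `ω`, at `∞` only if `D_∞(ω) > 0`. -/
def PathBound (D X : ℕ∞ → Ω → ℝ) (C : ℝ) (ω : Ω) : Prop :=
  (∀ n : ℕ, |X n ω| ≤ C) ∧ (0 < D ⊤ ω → |X ⊤ ω| ≤ C)

theorem IsModel.ae_pathBound [IsFiniteMeasure P] (h : IsModel 𝓕 P Q D) {X : ℕ∞ → Ω → ℝ}
    (hX : X ∈ RInf 𝓕 P) {C : ℝ} (hC : ∀ r, ∀ᵐ ω ∂P, |X r ω| ≤ C) :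
    ∀ᵐ ω ∂Q, PathBound D X C ω := by
  have h1 : ∀ᵐ ω ∂Q, ∀ n : ℕ, |X n ω| ≤ C :=
    ae_all_iff.2 fun n => h.ae_abs_le (hX.1 n) (hC n)
  have h2 : ∀ᵐ ω ∂Q, 0 < D ⊤ ω → |X ⊤ ω| ≤ C :=
    h.ae_of_ae_top (@measurableSet_le _ _ _ _ _ (⨆ n, 𝓕 n) _ _ _ _ _
      (_root_.measurable_abs.comp (hX.1 ⊤)) measurable_const) (hC ⊤)
  filter_upwards [h1, h2] with ω a b using ⟨a, b⟩

/-! ### Discounted sums along a path -/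

/-- `∑_{s ≥ t} γ_s X_s`, the sum including `s = ∞`. -/
def tailSum (D : ℕ∞ → Ω → ℝ) (t : ℕ) (X : ℕ∞ → Ω → ℝ) : Ω → ℝ := fun ω =>
  (∑' k : ℕ, weight D (t + k : ℕ) ω * X (t + k : ℕ) ω) + weight D ⊤ ω * X ⊤ ω

/-- The path properties of a discounting process. -/
structure RegularPath (D : ℕ∞ → Ω → ℝ) (ω : Ω) : Prop where
  zero : D 0 ω = 1
  antitone : Antitone fun n : ℕ => D n ω
  tendsto : Tendsto (fun n : ℕ => D n ω) atTop (𝓝 (D ⊤ ω))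
  nonneg_top : 0 ≤ D ⊤ ω

theorem IsModel.ae_regularPath (h : IsModel 𝓕 P Q D) : ∀ᵐ ω ∂Q, RegularPath D ω := by
  filter_upwards [h.isDiscounting.zero, h.isDiscounting.antitone, h.isDiscounting.tendsto,
    h.isDiscounting.nonneg] with ω a b c d using ⟨a, b, c, d⟩

/-- Valid also when D_t = 0, since division by zero gives zero on both sides. Working with the
undivided sum avoids this degenerate case elsewhere. -/
theorem discountedSum_eq (D : ℕ∞ → Ω → ℝ) (t : ℕ) (X : ℕ∞ → Ω → ℝ) (ω : Ω) :
    discountedSum D t X ω = tailSum D t X ω / D t ω := by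
  simp only [discountedSum, tailSum, add_div, ← tsum_div_const]
  congr 1
  · exact tsum_congr fun k => by ring
  · ring

theorem tailSum_proj (D : ℕ∞ → Ω → ℝ) (t : ℕ) (X : ℕ∞ → Ω → ℝ) :
    tailSum D t (proj t X) = tailSum D t X := by
  funext ω
  simp [tailSum, proj]

namespace RegularPath

variable {ω : Ω} {X Y : ℕ∞ → Ω → ℝ} {C C' : ℝ}

theorem top_le (h : RegularPath D ω) (t : ℕ) : D ⊤ ω ≤ D t ω := h.antitone.le_of_tendsto h.tendsto t

theorem nonneg (h : RegularPath D ω) (t : ℕ) : 0 ≤ D t ω := h.nonneg_top.trans (h.top_le t)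

theorem le_one (h : RegularPath D ω) (t : ℕ) : D t ω ≤ 1 :=
  (h.antitone (Nat.zero_le t)).trans h.zero.le

theorem weight_nonneg (h : RegularPath D ω) (n : ℕ) : 0 ≤ weight D n ω :=
  sub_nonneg.2 (h.antitone n.le_succ)

/-- The weights telescope, and D_t tends to D_∞ along a regular path. -/
theorem hasSum_weight (h : RegularPath D ω) (t : ℕ) :
    HasSum (fun k : ℕ => weight D (t + k : ℕ) ω) (D t ω - D ⊤ ω) := by
  rw [hasSum_iff_tendsto_nat_of_nonneg fun k => h.weight_nonneg _]
  have : ∀ n, ∑ k ∈ Finset.range n, weight D (t + k : ℕ) ω = D t ω - D (t + n : ℕ) ω := by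
    intro n
    exact Finset.sum_range_sub' (fun k => D (t + k : ℕ) ω) n
  simp only [this]
  refine tendsto_const_nhds.sub (h.tendsto.comp (tendsto_add_atTop_nat t |>.congr fun n => ?_))
  exact add_comm _ _

theorem abs_term_le (h : RegularPath D ω) (hX : PathBound D X C ω) (n : ℕ) :
    ‖weight D n ω * X n ω‖ ≤ C * weight D n ω := by
  rw [Real.norm_eq_abs, abs_mul, abs_of_nonneg (h.weight_nonneg n), mul_comm]
  exact mul_le_mul_of_nonneg_right (hX.1 n) (h.weight_nonneg n)

theorem summable (h : RegularPath D ω) (hX : PathBound D X C ω) (t : ℕ) :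
    Summable fun k : ℕ => weight D (t + k : ℕ) ω * X (t + k : ℕ) ω :=
  .of_norm_bounded ((h.hasSum_weight t).summable.mul_left C) fun _ => h.abs_term_le hX _

theorem abs_tsum_le (h : RegularPath D ω) (hX : PathBound D X C ω) (t : ℕ) :
    |∑' k : ℕ, weight D (t + k : ℕ) ω * X (t + k : ℕ) ω| ≤ C * (D t ω - D ⊤ ω) :=
  tsum_of_norm_bounded ((h.hasSum_weight t).mul_left C) fun _ => h.abs_term_le hX _

theorem abs_top_le (h : RegularPath D ω) (hX : PathBound D X C ω) :
    |weight D ⊤ ω * X ⊤ ω| ≤ C * D ⊤ ω := by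
  change |D ⊤ ω * X ⊤ ω| ≤ C * D ⊤ ω
  rcases h.nonneg_top.eq_or_lt with h0 | h0
  · simp [← h0]
  · rw [abs_mul, abs_of_pos h0, mul_comm]
    exact mul_le_mul_of_nonneg_right (hX.2 h0) h0.le

theorem abs_tailSum_le (h : RegularPath D ω) (hX : PathBound D X C ω) (t : ℕ) :
    |tailSum D t X ω| ≤ C * D t ω := by
  refine (abs_add_le _ _).trans ?_
  linarith [h.abs_tsum_le hX t, h.abs_top_le hX]

theorem tailSum_eq_sum_add (h : RegularPath D ω) (hX : PathBound D X C ω) {s t : ℕ}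
    (hst : s ≤ t) : tailSum D s X ω =
      ∑ r ∈ Finset.Ico s t, weight D r ω * X r ω + tailSum D t X ω := by
  obtain ⟨n, rfl⟩ := Nat.exists_eq_add_of_le hst
  rw [tailSum, tailSum, ← (h.summable hX s).sum_add_tsum_nat_add n, Finset.sum_Ico_eq_sum_range,
    Nat.add_sub_cancel_left, add_assoc]
  congr 2
  refine tsum_congr fun k => ?_
  rw [show s + (k + n) = s + n + k by ring]

theorem tailSum_add (h : RegularPath D ω) (hX : PathBound D X C ω) (hY : PathBound D Y C' ω)
    (t : ℕ) : tailSum D t (fun r ω => X r ω + Y r ω) ω = tailSum D t X ω + tailSum D t Y ω := by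
  simp only [tailSum, mul_add]
  rw [(h.summable hX t).tsum_add (h.summable hY t)]
  ring

theorem tailSum_cash (h : RegularPath D ω) (t : ℕ) (c : Ω → ℝ) :
    tailSum D t (cash t c) ω = D t ω * c ω := by
  have : ∀ k : ℕ, cash t c (t + k : ℕ) ω = c ω := fun k => by simp [cash]
  simp only [tailSum, this, tsum_mul_right, (h.hasSum_weight t).tsum_eq]
  rw [show weight D ⊤ = D ⊤ from rfl, show cash t c ⊤ ω = c ω by simp [cash]]
  ring

theorem tailSum_paste (h : RegularPath D ω) {s t : ℕ} (hst : s ≤ t)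
    (hZ : PathBound D (paste t X Y) C ω) : tailSum D s (paste t X Y) ω =
      ∑ r ∈ Finset.Ico s t, weight D r ω * X r ω + tailSum D t Y ω := by
  rw [h.tailSum_eq_sum_add hZ hst, ← tailSum_proj D t (paste t X Y), proj_paste, tailSum_proj]
  congr 1
  refine Finset.sum_congr rfl fun r hr => ?_
  have : ¬ (t : ℕ∞) ≤ (r : ℕ∞) := by exact_mod_cast not_le.2 (Finset.mem_Ico.1 hr).2
  simp [paste, this]

end RegularPath

theorem tailSum_convexComb {ω : Ω} {X Y : ℕ∞ → Ω → ℝ} {C C' : ℝ} (h : RegularPath D ω)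
    (hX : PathBound D X C ω) (hY : PathBound D Y C' ω) (t : ℕ) (l : Ω → ℝ) :
    tailSum D t (fun r ω => l ω * X r ω + (1 - l ω) * Y r ω) ω =
      l ω * tailSum D t X ω + (1 - l ω) * tailSum D t Y ω := by
  have : ∀ r : ℕ∞, weight D r ω * (l ω * X r ω + (1 - l ω) * Y r ω) =
      l ω * (weight D r ω * X r ω) + (1 - l ω) * (weight D r ω * Y r ω) := fun r => by ring
  simp only [tailSum, this]
  rw [((h.summable hX t).mul_left _).tsum_add ((h.summable hY t).mul_left _), tsum_mul_left,
    tsum_mul_left]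
  ring

/-! ### Measurability and integrability -/

theorem IsDiscounting.measurable_coe (h : IsDiscounting 𝓕 P Q D) (t : ℕ) :
    Measurable[𝓕 t] (D t) := by
  cases t with
  | zero => exact h.measurable_zero
  | succ n => exact (h.predictable n).mono (𝓕.mono n.le_succ) le_rfl

theorem IsDiscounting.measurable_weight (h : IsDiscounting 𝓕 P Q D) (t : ℕ) :
    Measurable[𝓕 t] (weight D t) := (h.measurable_coe t).sub (h.predictable t)

variable [IsFiniteMeasure P]

theorem IsModel.aestronglyMeasurable_tailSum (h : IsModel 𝓕 P Q D) {X : ℕ∞ → Ω → ℝ}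
    (hX : X ∈ RInf 𝓕 P) (t : ℕ) : AEStronglyMeasurable (tailSum D t X) Q := by
  obtain ⟨C, -, hC⟩ := exists_bound hX
  have hm : ∀ n : ℕ, Measurable fun ω => weight D n ω * X n ω := fun n =>
    ((h.isDiscounting.measurable_weight n).mul (hX.1 n)).mono (𝓕.le n) le_rfl
  have htop : Measurable fun ω => weight D ⊤ ω * X ⊤ ω :=
    (h.isDiscounting.measurable_top.mul (hX.1 ⊤)).mono (sigmaAt_le 𝓕 ⊤) le_rfl
  refine AEStronglyMeasurable.add ?_ htop.aestronglyMeasurable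
  refine aestronglyMeasurable_of_tendsto_ae atTop
    (f := fun n ω => ∑ k ∈ Finset.range n, weight D (t + k : ℕ) ω * X (t + k : ℕ) ω)
    (fun n => (Finset.measurable_sum _ fun k _ => hm (t + k)).aestronglyMeasurable) ?_
  filter_upwards [h.ae_regularPath, h.ae_pathBound hX hC] with ω h1 h2
  exact (h1.summable h2 t).hasSum.tendsto_sum_nat

theorem IsModel.integrable_tailSum (h : IsModel 𝓕 P Q D) {X : ℕ∞ → Ω → ℝ}
    (hX : X ∈ RInf 𝓕 P) (t : ℕ) : Integrable (tailSum D t X) Q := by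
  have := h.isProbabilityMeasure
  obtain ⟨C, hC0, hC⟩ := exists_bound hX
  refine Integrable.of_bound (h.aestronglyMeasurable_tailSum hX t) C ?_
  filter_upwards [h.ae_regularPath, h.ae_pathBound hX hC] with ω h1 h2
  exact (h1.abs_tailSum_le h2 t).trans (mul_le_of_le_one_right hC0 (h1.le_one t))

theorem IsModel.integrable_discountedSum (h : IsModel 𝓕 P Q D) {X : ℕ∞ → Ω → ℝ}
    (hX : X ∈ RInf 𝓕 P) (t : ℕ) : Integrable (discountedSum D t X) Q := by
  have := h.isProbabilityMeasure
  obtain ⟨C, hC0, hC⟩ := exists_bound hX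
  have hD := ((h.isDiscounting.measurable_coe t).mono (𝓕.le t) le_rfl).aestronglyMeasurable (μ := Q)
  refine Integrable.of_bound (C := C) ?_ ?_
  · simp only [funext (discountedSum_eq D t X)]
    exact ((h.aestronglyMeasurable_tailSum hX t).aemeasurable.div
      hD.aemeasurable).aestronglyMeasurable
  · filter_upwards [h.ae_regularPath, h.ae_pathBound hX hC] with ω h1 h2
    rw [discountedSum_eq, Real.norm_eq_abs, abs_div, abs_of_nonneg (h1.nonneg t)]
    exact div_le_of_le_mul₀ (h1.nonneg t) hC0 (h1.abs_tailSum_le h2 t)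

/-- The factor D_t is bounded and 𝓕_t-measurable, so it moves inside the conditional expectation and
cancels the denominator. -/
theorem IsModel.mul_condExp_discountedSum (h : IsModel 𝓕 P Q D) {X : ℕ∞ → Ω → ℝ}
    (hX : X ∈ RInf 𝓕 P) (t : ℕ) :
    (fun ω => D t ω * (Q[fun ω => -discountedSum D t X ω | 𝓕 t]) ω) =ᵐ[Q]
      Q[fun ω => -tailSum D t X ω | 𝓕 t] := by
  have := h.isProbabilityMeasure
  obtain ⟨C, hC0, hC⟩ := exists_bound hX
  have hpull := condExp_stronglyMeasurable_mul_of_bound (𝓕.le t) (μ := Q)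
    (h.isDiscounting.measurable_coe t).stronglyMeasurable (h.integrable_discountedSum hX t).neg 1
    (h.ae_regularPath.mono fun ω h1 => by
      rw [Real.norm_eq_abs, abs_of_nonneg (h1.nonneg t)]; exact h1.le_one t)
  refine hpull.symm.trans (condExp_congr_ae ?_)
  filter_upwards [h.ae_regularPath, h.ae_pathBound hX hC] with ω h1 h2
  have hb := h1.abs_tailSum_le h2 t
  simp only [Pi.mul_apply, Pi.neg_apply, discountedSum_eq]
  -- Where D_t = 0 the bound |∑_{s≥t} γ_s X_s| ≤ C D_t makes both sides vanish.
  by_cases h0 : D t ω = 0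
  · rw [h0, mul_zero] at hb
    rw [h0, abs_nonpos_iff.1 hb]; simp
  · field_simp

end

section

variable {Ω : Type*} {m : MeasurableSpace Ω}

/-! ### Essential suprema as countable suprema -/

/-- Among countable subfamilies, choose one whose pointwise supremum has maximal integral after a
bounded strictly increasing change of scale. No further member can increase it, so it is the
essential supremum. -/
theorem IsEssSupFamily.exists_seq {m' : MeasurableSpace Ω} (hm : m' ≤ m) {μ : Measure[m] Ω}
    [IsFiniteMeasure μ] {S : Set (Ω → EReal)} (hS : ∀ f ∈ S, Measurable[m'] f) (hne : S.Nonempty)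
    {g : Ω → EReal} (hg : IsEssSupFamily m' μ S g) :
    ∃ f : ℕ → Ω → EReal, (∀ n, f n ∈ S) ∧ g =ᵐ[μ] fun ω => ⨆ n, f n ω := by
  -- A strictly increasing map of the extended reals into [0, 1]: integrals stay finite and equality
  -- can be pulled back.
  set φ : EReal → ℝ := fun x =>
    (ENNReal.orderIsoUnitIntervalBirational (EReal.expOrderIso x) : ℝ)
  have hφm : StrictMono φ := fun a b hab =>
    ENNReal.orderIsoUnitIntervalBirational.strictMono (EReal.expOrderIso.strictMono hab)
  have hφ0 : ∀ x, 0 ≤ φ x := fun x =>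
    (ENNReal.orderIsoUnitIntervalBirational (EReal.expOrderIso x)).2.1
  set ψ : EReal → ℝ≥0∞ := fun x => ENNReal.ofReal (φ x)
  have hψm : Monotone ψ := fun a b hab => ENNReal.ofReal_le_ofReal (hφm.monotone hab)
  have hψi : ∀ a b, ψ a = ψ b → a = b := fun a b hab =>
    hφm.injective ((ENNReal.ofReal_eq_ofReal_iff (hφ0 a) (hφ0 b)).1 hab)
  have hψ1 : ∀ x, ψ x ≤ 1 := fun x => ENNReal.ofReal_le_one.2
    (ENNReal.orderIsoUnitIntervalBirational (EReal.expOrderIso x)).2.2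
  set G : (ℕ → S) → Ω → EReal := fun c ω => ⨆ n, (c n : Ω → EReal) ω
  have hGm : ∀ c, Measurable[m'] (G c) := fun c => Measurable.iSup fun n => hS _ (c n).2
  set I : (ℕ → S) → ℝ≥0∞ := fun c => ∫⁻ ω, ψ (G c ω) ∂μ
  obtain ⟨f₀, hf₀⟩ := hne
  obtain ⟨u, -, hut, hur⟩ := exists_seq_tendsto_sSup
    (⟨_, ⟨fun _ => ⟨f₀, hf₀⟩, rfl⟩⟩ : (range I).Nonempty) (OrderTop.bddAbove _)
  choose c hc using hur
  -- Merging all subfamilies of a maximizing sequence into one countable subfamily attains the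
  -- supremum of the integrals.
  set d : ℕ → S := fun n => c n.unpair.1 n.unpair.2 with hd
  have hcd : ∀ k, G (c k) ≤ G d := fun k ω => iSup_le fun n => by
    simpa [hd] using le_iSup (fun j => (d j : Ω → EReal) ω) (Nat.pair k n)
  have hIle : ∀ e, I e ≤ I d := by
    intro e
    refine (le_sSup (mem_range_self e)).trans (le_of_tendsto' hut fun k => ?_)
    rw [← hc k]
    exact lintegral_mono fun ω => hψm (hcd k ω)
  have hIfin : I d ≠ ∞ := by
    refine ne_top_of_le_ne_top (measure_ne_top μ univ) ?_
    calc I d ≤ ∫⁻ _, 1 ∂μ := lintegral_mono fun ω => hψ1 _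
      _ = μ univ := by simp
  refine ⟨fun n => d n, fun n => (d n).2, ?_⟩
  have h1 : g ≤ᵐ[μ] G d := by
    refine hg.least _ fun f hf => ?_
    set e : ℕ → S := fun n => Nat.casesOn n ⟨f, hf⟩ d
    have hde : G d ≤ G e := fun ω => iSup_le fun n =>
      le_iSup (fun j => (e j : Ω → EReal) ω) (n + 1)
    have hfe : f ≤ G e := fun ω => le_iSup (fun j => (e j : Ω → EReal) ω) 0
    have hae : (fun ω => ψ (G d ω)) =ᵐ[μ] fun ω => ψ (G e ω) :=
      ae_eq_of_ae_le_of_lintegral_le (Eventually.of_forall fun ω => hψm (hde ω)) hIfin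
        (hψm.measurable.comp ((hGm e).mono hm le_rfl)).aemeasurable (hIle e)
    filter_upwards [hae] with ω hω
    rw [hψi _ _ hω]
    exact hfe ω
  filter_upwards [h1, ae_all_iff.2 fun n => hg.upper _ (d n).2] with ω a b
  exact le_antisymm a (iSup_le b)

theorem toENNReal_iSup {f : ℕ → EReal} : (⨆ n, f n).toENNReal = ⨆ n, (f n).toENNReal :=
  Monotone.map_iSup_of_continuousAt EReal.continuous_toENNReal.continuousAt
    (fun _ _ h => EReal.toENNReal_le_toENNReal h) EReal.toENNReal_bot

/-! ### The lattice property of the penalty -/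

variable {𝓕 : Filtration ℕ m} {P Q : Measure Ω}
  {D : ℕ∞ → Ω → ℝ} {ρ : ℕ → (ℕ∞ → Ω → ℝ) → Ω → ℝ}

/-- The conditional expectations defining the penalty. -/
def condLoss (𝓕 : Filtration ℕ m) (Q : Measure Ω) (D : ℕ∞ → Ω → ℝ) (t : ℕ)
    (X : ℕ∞ → Ω → ℝ) : Ω → ℝ := Q[fun ω => -discountedSum D t X ω | 𝓕 t]

/-- The conditional expectation `E_Q[-∑_{s ≥ t} γ_s X_s | 𝓕_t]`. -/
def condTail (𝓕 : Filtration ℕ m) (Q : Measure Ω) (D : ℕ∞ → Ω → ℝ) (t : ℕ)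
    (X : ℕ∞ → Ω → ℝ) : Ω → ℝ := Q[fun ω => -tailSum D t X ω | 𝓕 t]

theorem measurable_condLoss (𝓕 : Filtration ℕ m) (Q : Measure Ω) (D : ℕ∞ → Ω → ℝ) (t : ℕ)
    (X : ℕ∞ → Ω → ℝ) : Measurable[𝓕 t] (condLoss 𝓕 Q D t X) :=
  stronglyMeasurable_condExp.measurable

/-- Take X on the 𝓕_t-event where its conditional loss is the larger one and Y elsewhere. Splitting
preserves acceptability, and the indicator comes out of the conditional expectation. Hence the
family of losses is directed upwards. -/
theorem IsModel.exists_condLoss_eq_max [IsFiniteMeasure P] (h : IsModel 𝓕 P Q D) {t : ℕ}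
    (hρ : IsCondConvexRiskMeasure 𝓕 P t (ρ t)) {X Y : ℕ∞ → Ω → ℝ}
    (hX : X ∈ acceptanceSet 𝓕 P t (ρ t)) (hY : Y ∈ acceptanceSet 𝓕 P t (ρ t)) :
    ∃ Z ∈ acceptanceSet 𝓕 P t (ρ t), condLoss 𝓕 Q D t Z =ᵐ[Q]
      fun ω => max (condLoss 𝓕 Q D t X ω) (condLoss 𝓕 Q D t Y ω) := by
  classical
  have := h.isProbabilityMeasure
  set B : Set Ω := {ω | condLoss 𝓕 Q D t Y ω ≤ condLoss 𝓕 Q D t X ω}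
  have hB : MeasurableSet[𝓕 t] B := @measurableSet_le _ _ _ _ _ (𝓕 t) _ _ _ _ _
    (measurable_condLoss 𝓕 Q D t Y) (measurable_condLoss 𝓕 Q D t X)
  set l : Ω → ℝ := B.indicator fun _ => 1
  have hl : Measurable[𝓕 t] l := (@measurable_const _ _ _ (𝓕 t) (1 : ℝ)).indicator hB
  have h01 : ∀ ω, 0 ≤ l ω ∧ l ω ≤ 1 := by
    intro ω
    by_cases hω : ω ∈ B <;> simp [l, hω]
  refine ⟨_, hρ.piecewise_mem_acceptanceSet hX hY hl h01, ?_⟩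
  have hXi := (h.integrable_discountedSum (RInfFrom_subset hX.1) t).neg
  have hYi := (h.integrable_discountedSum (RInfFrom_subset hY.1) t).neg
  have hl' : Measurable[𝓕 t] (fun ω => 1 - l ω) := measurable_const.sub hl
  have hlb : ∀ᵐ ω ∂Q, ‖l ω‖ ≤ 1 := Eventually.of_forall fun ω => by
    rw [Real.norm_eq_abs, abs_of_nonneg (h01 ω).1]; exact (h01 ω).2
  have hlb' : ∀ᵐ ω ∂Q, ‖1 - l ω‖ ≤ 1 := Eventually.of_forall fun ω => by
    rw [Real.norm_eq_abs, abs_of_nonneg (by linarith [h01 ω])]; linarith [h01 ω]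
  have hlX := condExp_stronglyMeasurable_mul_of_bound (𝓕.le t) hl.stronglyMeasurable hXi 1 hlb
  have hlY := condExp_stronglyMeasurable_mul_of_bound (𝓕.le t) hl'.stronglyMeasurable hYi 1 hlb'
  have hadd : Q[l * -discountedSum D t X + (fun ω => 1 - l ω) * -discountedSum D t Y | 𝓕 t]
      =ᵐ[Q] Q[l * -discountedSum D t X | 𝓕 t] +
        Q[(fun ω => 1 - l ω) * -discountedSum D t Y | 𝓕 t] :=
    condExp_add (hXi.bdd_mul (hl.mono (𝓕.le t) le_rfl).aestronglyMeasurable hlb)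
      (hYi.bdd_mul (hl'.mono (𝓕.le t) le_rfl).aestronglyMeasurable hlb') _
  obtain ⟨C, -, hC⟩ := exists_bound (RInfFrom_subset hX.1)
  obtain ⟨C', -, hC'⟩ := exists_bound (RInfFrom_subset hY.1)
  have hcongr : (fun ω => -discountedSum D t (fun r ω => l ω * X r ω + (1 - l ω) * Y r ω) ω) =ᵐ[Q]
      l * -discountedSum D t X + (fun ω => 1 - l ω) * -discountedSum D t Y := by
    filter_upwards [h.ae_regularPath, h.ae_pathBound (RInfFrom_subset hX.1) hC,
      h.ae_pathBound (RInfFrom_subset hY.1) hC'] with ω h1 h2 h3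
    simp only [Pi.add_apply, Pi.mul_apply, Pi.neg_apply, discountedSum_eq,
      tailSum_convexComb h1 h2 h3]
    ring
  filter_upwards [condExp_congr_ae (m := 𝓕 t) hcongr, hadd, hlX, hlY] with ω e1 e2 e3 e4
  change (Q[_ | 𝓕 t]) ω = _
  rw [e1, e2, Pi.add_apply, e3, e4]
  change l ω * condLoss 𝓕 Q D t X ω + (1 - l ω) * condLoss 𝓕 Q D t Y ω = _
  by_cases hω : ω ∈ B
  · simp only [l, indicator_of_mem hω]
    rw [max_eq_left hω]; ring
  · simp only [l, indicator_of_notMem hω]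
    rw [max_eq_right (le_of_not_ge hω)]; ring

theorem condLoss_zero (t : ℕ) : condLoss 𝓕 Q D t (fun _ _ => 0) = 0 := by
  have : (fun ω => -discountedSum D t (fun _ _ => 0) ω) = 0 := by
    funext ω; simp [discountedSum]
  rw [condLoss, this, condExp_zero]

/-! ### The discounted penalty as a limit of conditional losses -/

section Penalty

variable (𝓕 P Q D ρ) in
/-- The family whose essential supremum is the penalty. -/
def lossFamily (t : ℕ) : Set (Ω → EReal) :=
  (fun X ω => (condLoss 𝓕 Q D t X ω : EReal)) '' acceptanceSet 𝓕 P t (ρ t)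

theorem measurable_of_mem_lossFamily (t : ℕ) :
    ∀ f ∈ lossFamily 𝓕 P Q D ρ t, Measurable[𝓕 t] f := by
  rintro _ ⟨X, -, rfl⟩
  exact measurable_coe_real_ereal.comp (measurable_condLoss 𝓕 Q D t X)

theorem penalty_of_pos {t : ℕ} {ω : Ω} (hω : 0 < D t ω) :
    penalty 𝓕 P ρ Q D t ω = essSupFamily (𝓕 t) Q (lossFamily 𝓕 P Q D ρ t) ω := if_pos hω

theorem discountedPenalty_of_nonpos {t : ℕ} {ω : Ω} (hω : D t ω ≤ 0) :
    discountedPenalty 𝓕 P ρ Q D t ω = 0 := by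
  rw [discountedPenalty, ENNReal.ofReal_of_nonpos hω, zero_mul]

theorem IsModel.measurable_discountedPenalty (h : IsModel 𝓕 P Q D) (t : ℕ) :
    Measurable[𝓕 t] (discountedPenalty 𝓕 P ρ Q D t) := by
  have := h.isProbabilityMeasure
  have hess := isEssSupFamily_essSupFamily (𝓕.le t) Q (lossFamily 𝓕 P Q D ρ t)
    (measurable_of_mem_lossFamily t)
  have hD := h.isDiscounting.measurable_coe t
  have hpen : Measurable[𝓕 t] (penalty 𝓕 P ρ Q D t) :=
    Measurable.ite (@measurableSet_lt _ _ _ _ _ (𝓕 t) _ _ _ _ _ measurable_const hD)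
      hess.measurable measurable_const
  exact (ENNReal.measurable_ofReal.comp hD).mul (measurable_ereal_toENNReal.comp hpen)

/-- Conditional losses of acceptable positions are dominated by the discounted penalty. -/
theorem IsModel.condTail_le_discountedPenalty [IsFiniteMeasure P] (h : IsModel 𝓕 P Q D)
    {t : ℕ} {X : ℕ∞ → Ω → ℝ} (hX : X ∈ acceptanceSet 𝓕 P t (ρ t)) :
    ∀ᵐ ω ∂Q, ENNReal.ofReal (condTail 𝓕 Q D t X ω) ≤ discountedPenalty 𝓕 P ρ Q D t ω := by
  have := h.isProbabilityMeasure
  have hess := isEssSupFamily_essSupFamily (𝓕.le t) Q (lossFamily 𝓕 P Q D ρ t)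
    (measurable_of_mem_lossFamily t)
  filter_upwards [h.ae_regularPath, h.mul_condExp_discountedSum (RInfFrom_subset hX.1) t,
    hess.upper _ ⟨X, hX, rfl⟩] with ω h1 h2 h3
  rw [condTail, ← h2, ENNReal.ofReal_mul (h1.nonneg t)]
  rcases (h1.nonneg t).eq_or_lt with h0 | h0
  · simp [← h0]
  · rw [discountedPenalty, penalty_of_pos h0]
    gcongr
    exact EReal.toENNReal_le_toENNReal h3

/-- The discounted penalty is an increasing limit of conditional losses of acceptable
positions. -/
theorem IsModel.exists_seq_discountedPenalty [IsFiniteMeasure P] (h : IsModel 𝓕 P Q D) {t : ℕ}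
    (hρ : IsCondConvexRiskMeasure 𝓕 P t (ρ t)) :
    ∃ Y : ℕ → ℕ∞ → Ω → ℝ, (∀ n, Y n ∈ acceptanceSet 𝓕 P t (ρ t)) ∧
      ∀ᵐ ω ∂Q, Monotone (fun n => condTail 𝓕 Q D t (Y n) ω) ∧
        (∀ n, 0 ≤ condTail 𝓕 Q D t (Y n) ω) ∧
        discountedPenalty 𝓕 P ρ Q D t ω = ⨆ n, ENNReal.ofReal (condTail 𝓕 Q D t (Y n) ω) := by
  have := h.isProbabilityMeasure
  have hess := isEssSupFamily_essSupFamily (𝓕.le t) Q (lossFamily 𝓕 P Q D ρ t)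
    (measurable_of_mem_lossFamily t)
  obtain ⟨f, hf, hsup⟩ := hess.exists_seq (𝓕.le t) (measurable_of_mem_lossFamily t)
    ⟨_, ⟨_, hρ.zero_mem_acceptanceSet, rfl⟩⟩
  choose X hX hfX using hf
  choose! Z hZ hZmax using fun (X : ℕ∞ → Ω → ℝ) (hX : X ∈ acceptanceSet 𝓕 P t (ρ t))
    (Y : ℕ∞ → Ω → ℝ) (hY : Y ∈ acceptanceSet 𝓕 P t (ρ t)) =>
    h.exists_condLoss_eq_max hρ hX hY
  -- Running maxima of the sequence, started at the zero position so that all losses are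
  -- nonnegative.
  set Y : ℕ → ℕ∞ → Ω → ℝ := fun n => Nat.rec (fun _ _ => 0) (fun k y => Z y (X k)) n
  have hY : ∀ n, Y n ∈ acceptanceSet 𝓕 P t (ρ t) := by
    intro n
    induction n with
    | zero => exact hρ.zero_mem_acceptanceSet
    | succ k ih => exact hZ _ ih _ (hX k)
  refine ⟨Y, hY, ?_⟩
  filter_upwards [h.ae_regularPath,
    ae_all_iff.2 fun n => h.mul_condExp_discountedSum (RInfFrom_subset (hY n).1) t, hsup,
    ae_all_iff.2 fun n => hZmax _ (hY n) _ (hX n),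
    ae_all_iff.2 fun n => hess.upper _ ⟨Y n, hY n, rfl⟩] with ω h1 h2 h3 h4 h5
  have h2' : ∀ n, condTail 𝓕 Q D t (Y n) ω = D t ω * condLoss 𝓕 Q D t (Y n) ω :=
    fun n => (h2 n).symm
  have hstep : ∀ n, condLoss 𝓕 Q D t (Y (n + 1)) ω =
    max (condLoss 𝓕 Q D t (Y n) ω) (condLoss 𝓕 Q D t (X n) ω) := h4
  have hmono : Monotone fun n => condLoss 𝓕 Q D t (Y n) ω :=
    monotone_nat_of_le_succ fun n => by rw [hstep]; exact le_max_left _ _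
  have hmono' : Monotone fun n => condTail 𝓕 Q D t (Y n) ω := by
    simp only [h2']
    exact hmono.const_mul (h1.nonneg t)
  have hzero : condLoss 𝓕 Q D t (Y 0) ω = 0 := congrFun (condLoss_zero t) ω
  refine ⟨hmono', fun n => ?_, ?_⟩
  · rw [h2']
    exact mul_nonneg (h1.nonneg t) (hzero ▸ hmono (Nat.zero_le n))
  · simp only [h2', ENNReal.ofReal_mul (h1.nonneg t)]
    rcases (h1.nonneg t).eq_or_lt with h0 | h0
    · rw [discountedPenalty_of_nonpos h0.symm.le]; simp [← h0]
    · rw [← ENNReal.mul_iSup, discountedPenalty, penalty_of_pos h0]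
      congr 1
      refine le_antisymm ?_ (iSup_le fun n => EReal.toENNReal_le_toENNReal (h5 n))
      rw [h3, toENNReal_iSup]
      -- The n-th member of the sequence enters the running maximum at step n + 1.
      refine iSup_le fun n => le_iSup_of_le (n + 1) ?_
      rw [← hfX n]
      exact ENNReal.ofReal_le_ofReal (by rw [hstep]; exact le_max_right _ _)

end Penalty

end

section

variable {Ω : Type*} {m : MeasurableSpace Ω} {𝓕 : Filtration ℕ m} {P Q : Measure Ω}
  {D : ℕ∞ → Ω → ℝ} {ρ : ℕ → (ℕ∞ → Ω → ℝ) → Ω → ℝ}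

/-! ### The supermartingale property -/

theorem ofReal_integral_le_lintegral_ofReal {μ : Measure Ω} {f : Ω → ℝ} (hf : Integrable f μ) :
    ENNReal.ofReal (∫ ω, f ω ∂μ) ≤ ∫⁻ ω, ENNReal.ofReal (f ω) ∂μ := by
  rw [integral_eq_lintegral_pos_part_sub_lintegral_neg_part hf]
  exact (ENNReal.ofReal_le_ofReal (sub_le_self _ ENNReal.toReal_nonneg)).trans
    ENNReal.ofReal_toReal_le

/-- The discounted cost `-∑_{s ≤ r < t} γ_r X_r + D_t ρ_t(X)` of running `X` from `s` to `t`. -/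
def runningCost (D : ℕ∞ → Ω → ℝ) (ρ : ℕ → (ℕ∞ → Ω → ℝ) → Ω → ℝ) (X : ℕ∞ → Ω → ℝ) (s t : ℕ) :
    Ω → ℝ := fun ω =>
  -(∑ r ∈ Finset.Ico s t, weight D r ω * X r ω) + D t ω * ρ t (proj t X) ω

theorem RegularPath.abs_sum_le {ω : Ω} {X : ℕ∞ → Ω → ℝ} {C : ℝ} (h : RegularPath D ω)
    (hX : PathBound D X C ω) {s t : ℕ} (hst : s ≤ t) :
    |∑ r ∈ Finset.Ico s t, weight D r ω * X r ω| ≤ C * (D s ω - D t ω) := by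
  refine (Finset.abs_sum_le_sum_abs _ _).trans ?_
  calc ∑ r ∈ Finset.Ico s t, |weight D r ω * X r ω|
      ≤ ∑ r ∈ Finset.Ico s t, C * (D r ω - D (r + 1 : ℕ) ω) :=
        Finset.sum_le_sum fun r _ => h.abs_term_le hX r
    _ = C * (D s ω - D t ω) := by
        rw [← Finset.mul_sum, Finset.sum_Ico_eq_sum_range]
        obtain ⟨n, rfl⟩ := Nat.exists_eq_add_of_le hst
        rw [Nat.add_sub_cancel_left]
        exact congrArg (C * ·) (Finset.sum_range_sub' (fun k => D (s + k : ℕ) ω) n)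

theorem IsModel.ae_abs_risk_le (h : IsModel 𝓕 P Q D) (hρ : IsDynConvexRiskMeasure 𝓕 P ρ)
    {X : ℕ∞ → Ω → ℝ} (hX : X ∈ RInf 𝓕 P) {C : ℝ} (hC : ∀ r, ∀ᵐ ω ∂P, |X r ω| ≤ C) :
    ∀ᵐ ω ∂Q, ∀ t, |ρ t (proj t X) ω| ≤ C :=
  ae_all_iff.2 fun t => h.ae_abs_le ((hρ t).risk_mem hX).1 ((hρ t).abs_risk_le hX hC)

theorem IsModel.measurable_runningCost (h : IsModel 𝓕 P Q D)
    (hρ : IsDynConvexRiskMeasure 𝓕 P ρ) {X : ℕ∞ → Ω → ℝ} (hX : X ∈ RInf 𝓕 P) (s t : ℕ) :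
    Measurable[𝓕 t] (runningCost D ρ X s t) := by
  refine Measurable.add (Measurable.neg (Finset.measurable_sum _ fun r hr => ?_))
    ((h.isDiscounting.measurable_coe t).mul ((hρ t).risk_mem hX).1)
  exact ((h.isDiscounting.measurable_weight r).mul (hX.1 r)).mono
    (𝓕.mono (Finset.mem_Ico.1 hr).2.le) le_rfl

variable [IsFiniteMeasure P]

/-- The sum is at most C (D_s - D_t) and the risk term at most C D_t, in total C D_s ≤ C. -/
theorem IsModel.ae_abs_runningCost_le (h : IsModel 𝓕 P Q D) (hρ : IsDynConvexRiskMeasure 𝓕 P ρ)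
    {X : ℕ∞ → Ω → ℝ} (hX : X ∈ RInf 𝓕 P) {C : ℝ} (hC0 : 0 ≤ C)
    (hC : ∀ r, ∀ᵐ ω ∂P, |X r ω| ≤ C) :
    ∀ᵐ ω ∂Q, ∀ s t, s ≤ t → |runningCost D ρ X s t ω| ≤ C := by
  filter_upwards [h.ae_regularPath, h.ae_pathBound hX hC, h.ae_abs_risk_le hρ hX hC]
    with ω h1 h2 h3 s t hst
  refine (abs_add_le _ _).trans ?_
  have h4 : |D t ω * ρ t (proj t X) ω| ≤ D t ω * C := by
    rw [abs_mul, abs_of_nonneg (h1.nonneg t)]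
    exact mul_le_mul_of_nonneg_left (h3 t) (h1.nonneg t)
  rw [abs_neg]
  have h5 := h1.abs_sum_le h2 hst
  nlinarith [mul_le_of_le_one_right hC0 (h1.le_one s)]

theorem IsModel.integrable_runningCost (h : IsModel 𝓕 P Q D) (hρ : IsDynConvexRiskMeasure 𝓕 P ρ)
    {X : ℕ∞ → Ω → ℝ} (hX : X ∈ RInf 𝓕 P) {s t : ℕ} (hst : s ≤ t) :
    Integrable (runningCost D ρ X s t) Q := by
  have := h.isProbabilityMeasure
  obtain ⟨C, hC0, hC⟩ := exists_bound hX
  refine Integrable.of_bound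
    ((h.measurable_runningCost hρ hX s t).mono (𝓕.le t) le_rfl).aestronglyMeasurable C ?_
  filter_upwards [h.ae_abs_runningCost_le hρ hX hC0 hC] with ω hω using hω s t hst

theorem runningCost_self (X : ℕ∞ → Ω → ℝ) (s : ℕ) (ω : Ω) :
    runningCost D ρ X s s ω = D s ω * ρ s (proj s X) ω := by
  simp [runningCost]

/-- Z is the pasted position. Cash c paid from u on contributes D_u c to the discounted sum, so its
two cash streams produce exactly the two risk terms of the running costs. -/
theorem IsModel.exists_acceptable_tailSum_eq (h : IsModel 𝓕 P Q D)
    (hρ : IsDynConvexRiskMeasure 𝓕 P ρ) (htc : TimeConsistent 𝓕 P ρ) {X Y : ℕ∞ → Ω → ℝ}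
    (hX : X ∈ RInf 𝓕 P) {s t : ℕ} (hst : s ≤ t) (hY : Y ∈ acceptanceSet 𝓕 P t (ρ t)) :
    ∃ Z ∈ acceptanceSet 𝓕 P s (ρ s), ∀ᵐ ω ∂Q, -tailSum D t Y ω + runningCost D ρ X s t ω =
      -tailSum D s Z ω + runningCost D ρ X s s ω := by
  refine ⟨_, paste_mem_acceptanceSet hρ htc hX hst hY, ?_⟩
  have hYR := RInfFrom_subset hY.1
  have hV := cash_mem_RInf (neg_mem_LInf ((hρ t).risk_mem hX))
  have hYV := add_mem_RInf hYR hV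
  have hp := paste_mem_RInf hX hYV t
  have hU := cash_mem_RInf ((hρ s).risk_mem hX)
  obtain ⟨C1, -, hC1⟩ := exists_bound hYR
  obtain ⟨C2, -, hC2⟩ := exists_bound hV
  obtain ⟨C3, -, hC3⟩ := exists_bound hp
  obtain ⟨C4, -, hC4⟩ := exists_bound hU
  filter_upwards [h.ae_regularPath, h.ae_pathBound hYR hC1, h.ae_pathBound hV hC2,
    h.ae_pathBound hp hC3, h.ae_pathBound hU hC4] with ω h0 h1 h2 h3 h4
  rw [tailSum_proj, h0.tailSum_add h3 h4, h0.tailSum_paste hst h3, h0.tailSum_add h1 h2,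
    h0.tailSum_cash, h0.tailSum_cash, runningCost_self, runningCost]
  ring

/-- The process `W_t + D_t ρ_t(X) - ∑_{r < t} γ_r X_r`, with `W` the discounted penalty, is a
supermartingale, in integrated form. -/
theorem IsModel.setLIntegral_discountedPenalty_add_le (h : IsModel 𝓕 P Q D)
    (hρ : IsDynConvexRiskMeasure 𝓕 P ρ) (htc : TimeConsistent 𝓕 P ρ) {X : ℕ∞ → Ω → ℝ}
    (hX : X ∈ RInf 𝓕 P) {s t : ℕ} (hst : s ≤ t) {c : ℝ}
    (hc : ∀ᵐ ω ∂Q, 0 ≤ runningCost D ρ X s t ω + c) {B : Set Ω} (hB : MeasurableSet[𝓕 s] B) :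
    (∫⁻ ω in B, discountedPenalty 𝓕 P ρ Q D t ω ∂Q) +
        ∫⁻ ω in B, ENNReal.ofReal (runningCost D ρ X s t ω + c) ∂Q ≤
      (∫⁻ ω in B, discountedPenalty 𝓕 P ρ Q D s ω ∂Q) +
        ∫⁻ ω in B, ENNReal.ofReal (runningCost D ρ X s s ω + c) ∂Q := by
  have := h.isProbabilityMeasure
  obtain ⟨Y, hY, hYlim⟩ := h.exists_seq_discountedPenalty (hρ t)
  have hBt : MeasurableSet[𝓕 t] B := 𝓕.mono hst _ hB
  have hUi := (h.integrable_runningCost hρ hX hst).add (integrable_const c)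
  have hRi := (h.integrable_runningCost hρ hX (le_refl s)).add (integrable_const c)
  have hmeas : ∀ n, AEMeasurable (fun ω => ENNReal.ofReal (condTail 𝓕 Q D t (Y n) ω))
      (Q.restrict B) := fun n =>
    (ENNReal.measurable_ofReal.comp
      (stronglyMeasurable_condExp.measurable.mono (𝓕.le t) le_rfl)).aemeasurable
  -- Monotone convergence reduces the claim to a single acceptable Y_n. Finiteness of W is not yet
  -- known, so the argument uses nonnegative integrals; the shift c makes the running cost at t
  -- nonnegative.
  have hW : ∫⁻ ω in B, discountedPenalty 𝓕 P ρ Q D t ω ∂Q =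
      ⨆ n, ∫⁻ ω in B, ENNReal.ofReal (condTail 𝓕 Q D t (Y n) ω) ∂Q := by
    rw [← lintegral_iSup' hmeas]
    · exact lintegral_congr_ae (ae_restrict_of_ae (hYlim.mono fun ω hω => hω.2.2))
    · exact ae_restrict_of_ae (hYlim.mono fun ω hω i j hij =>
        ENNReal.ofReal_le_ofReal (hω.1 hij))
  rw [hW, ENNReal.iSup_add]
  refine iSup_le fun n => ?_
  obtain ⟨Z, hZ, hZeq⟩ := h.exists_acceptable_tailSum_eq hρ htc hX hst (hY n)
  have hYi := (h.integrable_tailSum (RInfFrom_subset (hY n).1) t).neg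
  have hZi := (h.integrable_tailSum (RInfFrom_subset hZ.1) s).neg
  have hfi : Integrable (condTail 𝓕 Q D t (Y n)) Q := integrable_condExp
  have hgi : Integrable (condTail 𝓕 Q D s Z) Q := integrable_condExp
  -- B lies in both σ-fields, so over B conditional losses integrate like the losses themselves.
  -- This allows Y_n to be exchanged for Z, whose conditional loss is dominated by W_s.
  calc (∫⁻ ω in B, ENNReal.ofReal (condTail 𝓕 Q D t (Y n) ω) ∂Q) +
        ∫⁻ ω in B, ENNReal.ofReal (runningCost D ρ X s t ω + c) ∂Q
      = ∫⁻ ω in B, ENNReal.ofReal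
          (condTail 𝓕 Q D t (Y n) ω + (runningCost D ρ X s t ω + c)) ∂Q := by
        rw [← lintegral_add_left' (hmeas n)]
        refine lintegral_congr_ae (ae_restrict_of_ae ?_)
        filter_upwards [hYlim, hc] with ω h1 h2
        rw [ENNReal.ofReal_add (h1.2.1 n) h2]
    _ = ENNReal.ofReal
          (∫ ω in B, (condTail 𝓕 Q D t (Y n) ω + (runningCost D ρ X s t ω + c)) ∂Q) := by
        refine (ofReal_integral_eq_lintegral_ofReal (hfi.add hUi).integrableOn
          (ae_restrict_of_ae ?_)).symm
        filter_upwards [hYlim, hc] with ω h1 h2 using add_nonneg (h1.2.1 n) h2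
    _ = ENNReal.ofReal ((∫ ω in B, condTail 𝓕 Q D s Z ω ∂Q) +
          ∫ ω in B, (runningCost D ρ X s s ω + c) ∂Q) := by
        congr 1
        have e1 : ∫ ω in B, condTail 𝓕 Q D t (Y n) ω ∂Q = ∫ ω in B, -tailSum D t (Y n) ω ∂Q :=
          setIntegral_condExp (𝓕.le t) hYi hBt
        have e2 : ∫ ω in B, condTail 𝓕 Q D s Z ω ∂Q = ∫ ω in B, -tailSum D s Z ω ∂Q :=
          setIntegral_condExp (𝓕.le s) hZi hB
        have e3 : ∫ ω in B, (condTail 𝓕 Q D t (Y n) ω + (runningCost D ρ X s t ω + c)) ∂Q =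
            (∫ ω in B, condTail 𝓕 Q D t (Y n) ω ∂Q) + ∫ ω in B, (runningCost D ρ X s t ω + c) ∂Q :=
          integral_add hfi.integrableOn hUi.integrableOn
        have e4 : ∫ ω in B, (-tailSum D t (Y n) ω + (runningCost D ρ X s t ω + c)) ∂Q =
            (∫ ω in B, -tailSum D t (Y n) ω ∂Q) + ∫ ω in B, (runningCost D ρ X s t ω + c) ∂Q :=
          integral_add hYi.integrableOn hUi.integrableOn
        have e5 : ∫ ω in B, (-tailSum D s Z ω + (runningCost D ρ X s s ω + c)) ∂Q =
            (∫ ω in B, -tailSum D s Z ω ∂Q) + ∫ ω in B, (runningCost D ρ X s s ω + c) ∂Q :=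
          integral_add hZi.integrableOn hRi.integrableOn
        rw [e3, e1, e2, ← e4, ← e5]
        refine integral_congr_ae (ae_restrict_of_ae ?_)
        filter_upwards [hZeq] with ω hω
        rw [← add_assoc, hω, add_assoc]
    _ ≤ ENNReal.ofReal (∫ ω in B, condTail 𝓕 Q D s Z ω ∂Q) +
          ENNReal.ofReal (∫ ω in B, (runningCost D ρ X s s ω + c) ∂Q) := ENNReal.ofReal_add_le
    _ ≤ _ := by
        refine add_le_add ((ofReal_integral_le_lintegral_ofReal hgi.integrableOn).trans ?_)
          (ofReal_integral_le_lintegral_ofReal hRi.integrableOn)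
        exact lintegral_mono_ae (ae_restrict_of_ae (h.condTail_le_discountedPenalty hZ))

/-- The case X = 0, where the running cost vanishes: W is a supermartingale, in integrated form. -/
theorem IsModel.setLIntegral_discountedPenalty_le (h : IsModel 𝓕 P Q D)
    (hρ : IsDynConvexRiskMeasure 𝓕 P ρ) (htc : TimeConsistent 𝓕 P ρ) {s t : ℕ} (hst : s ≤ t)
    {B : Set Ω} (hB : MeasurableSet[𝓕 s] B) :
    ∫⁻ ω in B, discountedPenalty 𝓕 P ρ Q D t ω ∂Q ≤
      ∫⁻ ω in B, discountedPenalty 𝓕 P ρ Q D s ω ∂Q := by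
  have h0 : ∀ s t, s ≤ t → ∀ᵐ ω ∂Q, runningCost D ρ (fun _ _ => 0) s t ω + 0 = 0 := by
    intro s t hst
    filter_upwards [h.ae_abs_runningCost_le hρ zero_mem_RInf le_rfl
      fun _ => Eventually.of_forall fun _ => by simp] with ω hω
    simpa using hω s t hst
  have key := h.setLIntegral_discountedPenalty_add_le hρ htc zero_mem_RInf hst
    ((h0 s t hst).mono fun ω hω => hω.ge) hB
  have hz : ∀ s t, s ≤ t →
      ∫⁻ ω in B, ENNReal.ofReal (runningCost D ρ (fun _ _ => 0) s t ω + 0) ∂Q = 0 := by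
    intro s t hst
    rw [lintegral_congr_ae (g := fun _ => 0) (ae_restrict_of_ae ?_), lintegral_zero]
    filter_upwards [h0 s t hst] with ω hω
    rw [hω, ENNReal.ofReal_zero]
  rwa [hz s t hst, hz s s le_rfl, add_zero, add_zero] at key

theorem IsModel.lintegral_discountedPenalty_antitone (h : IsModel 𝓕 P Q D)
    (hρ : IsDynConvexRiskMeasure 𝓕 P ρ) (htc : TimeConsistent 𝓕 P ρ) :
    Antitone fun t => ∫⁻ ω, discountedPenalty 𝓕 P ρ Q D t ω ∂Q := by
  intro s t hst
  simpa using h.setLIntegral_discountedPenalty_le hρ htc hst (B := univ) MeasurableSet.univ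

theorem IsModel.condLExp_discountedPenalty_le (h : IsModel 𝓕 P Q D)
    (hρ : IsDynConvexRiskMeasure 𝓕 P ρ) (htc : TimeConsistent 𝓕 P ρ) {s t u : ℕ} (hst : s ≤ t)
    (hus : u ≤ s) : condLExp (𝓕 u) Q (discountedPenalty 𝓕 P ρ Q D t) ≤ᵐ[Q]
      condLExp (𝓕 u) Q (discountedPenalty 𝓕 P ρ Q D s) := by
  have := h.isProbabilityMeasure
  refine ae_le_of_ae_le_trim (hm := 𝓕.le u) ?_
  refine ae_le_of_forall_setLIntegral_le_of_sigmaFinite (measurable_condLExp _ _ _)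
    fun B hB _ => ?_
  rw [setLIntegral_condLExp_trim (𝓕.le u) _ _ hB, setLIntegral_condLExp_trim (𝓕.le u) _ _ hB]
  exact h.setLIntegral_discountedPenalty_le hρ htc hst (𝓕.mono hus _ hB)

/-- W_0 is constant because 𝓕_0 is trivial, and finite by assumption; expectations of W decrease
from there. -/
theorem IsModel.lintegral_discountedPenalty_ne_top (h : IsModel 𝓕 P Q D) (h𝓕 : 𝓕 0 = ⊥)
    (hρ : IsDynConvexRiskMeasure 𝓕 P ρ) (htc : TimeConsistent 𝓕 P ρ)
    (hfin : FinitePenalty 𝓕 P ρ Q D) (t : ℕ) :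
    ∫⁻ ω, discountedPenalty 𝓕 P ρ Q D t ω ∂Q ≠ ∞ := by
  have := h.isProbabilityMeasure
  refine ne_top_of_le_ne_top ?_ (h.lintegral_discountedPenalty_antitone hρ htc (Nat.zero_le t))
  have hm := h.measurable_discountedPenalty (ρ := ρ) 0
  rw [h𝓕] at hm
  obtain ⟨c, hc⟩ := eq_const_of_measurable_bot hm
  obtain ⟨ω, hω⟩ := hfin.exists
  have hlt : discountedPenalty 𝓕 P ρ Q D 0 ω ≠ ∞ := by
    rw [discountedPenalty]
    exact ENNReal.mul_ne_top ENNReal.ofReal_ne_top (EReal.toENNReal_ne_top_iff.2 hω.ne)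
  change ∫⁻ ω, discountedPenalty 𝓕 P ρ Q D 0 ω ∂Q ≠ ∞
  rw [hc] at hlt ⊢
  simpa using hlt

/-! ### Convergence -/

theorem IsModel.ae_discountedPenalty_ne_top (h : IsModel 𝓕 P Q D) (h𝓕 : 𝓕 0 = ⊥)
    (hρ : IsDynConvexRiskMeasure 𝓕 P ρ) (htc : TimeConsistent 𝓕 P ρ)
    (hfin : FinitePenalty 𝓕 P ρ Q D) (t : ℕ) :
    ∀ᵐ ω ∂Q, discountedPenalty 𝓕 P ρ Q D t ω ≠ ∞ :=
  (ae_lt_top ((h.measurable_discountedPenalty t).mono (𝓕.le t) le_rfl)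
    (h.lintegral_discountedPenalty_ne_top h𝓕 hρ htc hfin t)).mono fun _ hω => hω.ne

theorem IsModel.integrable_toReal_discountedPenalty (h : IsModel 𝓕 P Q D) (h𝓕 : 𝓕 0 = ⊥)
    (hρ : IsDynConvexRiskMeasure 𝓕 P ρ) (htc : TimeConsistent 𝓕 P ρ)
    (hfin : FinitePenalty 𝓕 P ρ Q D) (t : ℕ) :
    Integrable (fun ω => (discountedPenalty 𝓕 P ρ Q D t ω).toReal) Q :=
  integrable_toReal_of_lintegral_ne_top
    ((h.measurable_discountedPenalty t).mono (𝓕.le t) le_rfl).aemeasurable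
    (h.lintegral_discountedPenalty_ne_top h𝓕 hρ htc hfin t)

/-- With W integrable, the shift by the bound C of X can be removed and the inequality read in real
integrals. -/
theorem IsModel.setIntegral_discountedPenalty_add_le (h : IsModel 𝓕 P Q D) (h𝓕 : 𝓕 0 = ⊥)
    (hρ : IsDynConvexRiskMeasure 𝓕 P ρ) (htc : TimeConsistent 𝓕 P ρ)
    (hfin : FinitePenalty 𝓕 P ρ Q D) {X : ℕ∞ → Ω → ℝ} (hX : X ∈ RInf 𝓕 P) {s t : ℕ}
    (hst : s ≤ t) {B : Set Ω} (hB : MeasurableSet[𝓕 s] B) :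
    ∫ ω in B, ((discountedPenalty 𝓕 P ρ Q D t ω).toReal + runningCost D ρ X s t ω) ∂Q ≤
      ∫ ω in B, ((discountedPenalty 𝓕 P ρ Q D s ω).toReal + runningCost D ρ X s s ω) ∂Q := by
  have := h.isProbabilityMeasure
  obtain ⟨C, hC0, hC⟩ := exists_bound hX
  have hU : ∀ u, s ≤ u → ∀ᵐ ω ∂Q, 0 ≤ runningCost D ρ X s u ω + C := by
    intro u hu
    filter_upwards [h.ae_abs_runningCost_le hρ hX hC0 hC] with ω hω
    linarith [(abs_le.1 (hω s u hu)).1]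
  have hi : ∀ u, s ≤ u → Integrable (fun ω => (discountedPenalty 𝓕 P ρ Q D u ω).toReal +
      runningCost D ρ X s u ω) Q := fun u hu =>
    (h.integrable_toReal_discountedPenalty h𝓕 hρ htc hfin u).add
      (h.integrable_runningCost hρ hX hu)
  have hiC : ∀ u, s ≤ u → Integrable (fun ω => (discountedPenalty 𝓕 P ρ Q D u ω).toReal +
      runningCost D ρ X s u ω + C) Q := fun u hu => (hi u hu).add (integrable_const C)
  have hconv : ∀ u, s ≤ u → (∫⁻ ω in B, discountedPenalty 𝓕 P ρ Q D u ω ∂Q) +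
      ∫⁻ ω in B, ENNReal.ofReal (runningCost D ρ X s u ω + C) ∂Q = ENNReal.ofReal
      (∫ ω in B, ((discountedPenalty 𝓕 P ρ Q D u ω).toReal + runningCost D ρ X s u ω + C) ∂Q) := by
    intro u hu
    rw [ofReal_integral_eq_lintegral_ofReal (hiC u hu).integrableOn,
      ← lintegral_add_left ((h.measurable_discountedPenalty u).mono (𝓕.le u) le_rfl)]
    · refine lintegral_congr_ae (ae_restrict_of_ae ?_)
      filter_upwards [hU u hu, h.ae_discountedPenalty_ne_top h𝓕 hρ htc hfin u] with ω h1 h2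
      rw [add_assoc, ENNReal.ofReal_add ENNReal.toReal_nonneg h1,
        ENNReal.ofReal_toReal h2]
    · refine ae_restrict_of_ae ?_
      filter_upwards [hU u hu] with ω h1
      simp only [Pi.zero_apply, add_assoc]
      exact add_nonneg ENNReal.toReal_nonneg h1
  have key := h.setLIntegral_discountedPenalty_add_le hρ htc hX hst (hU t hst) hB
  rw [hconv t hst, hconv s le_rfl, ENNReal.ofReal_le_ofReal_iff,
    integral_add (hi t hst).integrableOn
    (integrable_const C).integrableOn, integral_add (hi s le_rfl).integrableOn
    (integrable_const C).integrableOn] at key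
  · exact le_of_add_le_add_right key
  · refine integral_nonneg_of_ae (ae_restrict_of_ae ?_)
    filter_upwards [hU s le_rfl] with ω h1
    simp only [Pi.zero_apply, add_assoc]
    exact add_nonneg ENNReal.toReal_nonneg h1

/-- The supermartingale `W_t + D_t ρ_t(X) - ∑_{r < t} γ_r X_r` converges. -/
theorem IsModel.ae_tendsto_discountedPenalty_add (h : IsModel 𝓕 P Q D) (h𝓕 : 𝓕 0 = ⊥)
    (hρ : IsDynConvexRiskMeasure 𝓕 P ρ) (htc : TimeConsistent 𝓕 P ρ)
    (hfin : FinitePenalty 𝓕 P ρ Q D) {X : ℕ∞ → Ω → ℝ} (hX : X ∈ RInf 𝓕 P) :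
    ∀ᵐ ω ∂Q, ∃ l : ℝ, Tendsto (fun t => (discountedPenalty 𝓕 P ρ Q D t ω).toReal +
      runningCost D ρ X 0 t ω) atTop (𝓝 l) := by
  have := h.isProbabilityMeasure
  obtain ⟨C, hC0, hC⟩ := exists_bound hX
  set V : ℕ → Ω → ℝ := fun t ω => (discountedPenalty 𝓕 P ρ Q D t ω).toReal +
      runningCost D ρ X 0 t ω
  have hVi : ∀ t, Integrable (V t) Q := fun t =>
    (h.integrable_toReal_discountedPenalty h𝓕 hρ htc hfin t).add
      (h.integrable_runningCost hρ hX (Nat.zero_le t))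
  have hV : Supermartingale V 𝓕 Q := by
    refine supermartingale_of_setIntegral_succ_le (fun t => ?_) hVi fun t B hB => ?_
    · exact ((h.measurable_discountedPenalty t).ennreal_toReal.add
        (h.measurable_runningCost hρ hX 0 t)).stronglyMeasurable
    -- The costs before t occur in both V_t and V_{t+1}; subtracting them leaves the inequality for
    -- X restarted at t.
    · set S : Ω → ℝ := fun ω => ∑ r ∈ Finset.range t, weight D r ω * X r ω
      have hsplit : ∀ u, t ≤ u → ∀ ω, V u ω = ((discountedPenalty 𝓕 P ρ Q D u ω).toReal +
          runningCost D ρ X t u ω) - S ω := by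
        intro u hu ω
        simp only [V, S, runningCost, ← Finset.sum_Ico_consecutive _ (Nat.zero_le t) hu,
          Finset.range_eq_Ico]
        ring
      have hi : ∀ u, t ≤ u → Integrable (fun ω => (discountedPenalty 𝓕 P ρ Q D u ω).toReal +
          runningCost D ρ X t u ω) Q := fun u hu =>
        (h.integrable_toReal_discountedPenalty h𝓕 hρ htc hfin u).add
          (h.integrable_runningCost hρ hX hu)
      have hS : Integrable S Q := by
        have := (hi t le_rfl).sub (hVi t)
        refine this.congr (Eventually.of_forall fun ω => ?_)
        simp [hsplit t le_rfl ω]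
      simp only [hsplit _ t.le_succ, hsplit t le_rfl]
      rw [integral_sub (hi _ t.le_succ).integrableOn hS.integrableOn,
        integral_sub (hi t le_rfl).integrableOn hS.integrableOn]
      exact sub_le_sub_right
        (h.setIntegral_discountedPenalty_add_le h𝓕 hρ htc hfin hX t.le_succ hB) _
  set K : ℝ≥0∞ := (∫⁻ ω, discountedPenalty 𝓕 P ρ Q D 0 ω ∂Q) + ENNReal.ofReal C
  have hK : K ≠ ∞ := ENNReal.add_ne_top.2
    ⟨h.lintegral_discountedPenalty_ne_top h𝓕 hρ htc hfin 0, ENNReal.ofReal_ne_top⟩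
  -- E_Q|V_t| is at most w_0 plus the bound C of the running cost. The sign turns V into a
  -- submartingale for the convergence theorem.
  have hbdd : ∀ t, eLpNorm ((-V) t) 1 Q ≤ K.toNNReal := by
    intro t
    rw [ENNReal.coe_toNNReal hK, Pi.neg_apply, eLpNorm_neg, eLpNorm_one_eq_lintegral_enorm]
    calc ∫⁻ ω, ‖V t ω‖ₑ ∂Q
        ≤ ∫⁻ ω, (discountedPenalty 𝓕 P ρ Q D t ω + ENNReal.ofReal C) ∂Q := by
          refine lintegral_mono_ae ?_
          filter_upwards [h.ae_abs_runningCost_le hρ hX hC0 hC] with ω hω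
          refine (enorm_add_le _ _).trans (add_le_add ?_ ?_)
          · rw [Real.enorm_of_nonneg ENNReal.toReal_nonneg]
            exact ENNReal.ofReal_toReal_le
          · rw [Real.enorm_eq_ofReal_abs]
            exact ENNReal.ofReal_le_ofReal (hω 0 t (Nat.zero_le t))
      _ = (∫⁻ ω, discountedPenalty 𝓕 P ρ Q D t ω ∂Q) + ENNReal.ofReal C := by
          rw [lintegral_add_right _ measurable_const]; simp
      _ ≤ K := add_le_add_left (h.lintegral_discountedPenalty_antitone hρ htc (Nat.zero_le t)) _
  filter_upwards [hV.neg.ae_tendsto_limitProcess hbdd] with ω hω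
  exact ⟨_, by simpa using hω.neg⟩

/-- `D_t ρ_t(X)` converges; in particular `ρ_t(X)` converges on `{D_∞ > 0}`. -/
theorem IsModel.ae_tendsto_mul_risk (h : IsModel 𝓕 P Q D) (h𝓕 : 𝓕 0 = ⊥)
    (hρ : IsDynConvexRiskMeasure 𝓕 P ρ) (htc : TimeConsistent 𝓕 P ρ)
    (hfin : FinitePenalty 𝓕 P ρ Q D) {X : ℕ∞ → Ω → ℝ} (hX : X ∈ RInf 𝓕 P) :
    ∀ᵐ ω ∂Q, ∃ l : ℝ, Tendsto (fun t : ℕ => D t ω * ρ t (proj t X) ω) atTop (𝓝 l) := by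
  obtain ⟨C, hC0, hC⟩ := exists_bound hX
  filter_upwards [h.ae_tendsto_discountedPenalty_add h𝓕 hρ htc hfin hX,
    h.ae_tendsto_discountedPenalty_add h𝓕 hρ htc hfin zero_mem_RInf,
    h.ae_regularPath, h.ae_pathBound hX hC, h.ae_abs_runningCost_le hρ zero_mem_RInf le_rfl
      fun _ => Eventually.of_forall fun _ => by simp] with ω ⟨l, hl⟩ ⟨l', hl'⟩ h1 h2 h3
  have h0 : ∀ t, runningCost D ρ (fun _ _ => 0) 0 t ω = 0 := fun t => by
    simpa using h3 0 t (Nat.zero_le t)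
  simp only [h0, add_zero] at hl'
  have hs := (h1.summable h2 0).hasSum.tendsto_sum_nat
  -- The limit for X minus the limit for 0 removes W; adding back the convergent sum of γ_r X_r
  -- isolates D_t ρ_t(X).
  refine ⟨_, ((hl.sub hl').add hs).congr fun t => ?_⟩
  simp only [runningCost, Finset.range_eq_Ico, zero_add]
  ring

theorem IsModel.ae_tendsto_risk (h : IsModel 𝓕 P Q D) (h𝓕 : 𝓕 0 = ⊥)
    (hρ : IsDynConvexRiskMeasure 𝓕 P ρ) (htc : TimeConsistent 𝓕 P ρ)
    (hfin : FinitePenalty 𝓕 P ρ Q D) {X : ℕ∞ → Ω → ℝ} (hX : X ∈ RInf 𝓕 P) :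
    ∀ᵐ ω ∂Q, 0 < D ⊤ ω →
      ∃ l : ℝ, Tendsto (fun t : ℕ => ρ t (proj t X) ω) atTop (𝓝 l) := by
  filter_upwards [h.ae_tendsto_mul_risk h𝓕 hρ htc hfin hX, h.ae_regularPath] with ω ⟨l, hl⟩ h1 hpos
  refine ⟨_, (hl.div h1.tendsto hpos.ne').congr fun t => ?_⟩
  exact mul_div_cancel_left₀ _ (hpos.trans_le (h1.top_le t)).ne'

end

section

variable {Ω : Type*} {m : MeasurableSpace Ω} {𝓕 : Filtration ℕ m} {P Q : Measure Ω}
  {D : ℕ∞ → Ω → ℝ} {ρ : ℕ → (ℕ∞ → Ω → ℝ) → Ω → ℝ}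

/-! ### Potentials and bubbles -/

/-- Conditioning on the trivial 𝓕_0 gives expectations, so the bubble at time 0 is the upper limit
of w_t. -/
theorem IsModel.tendsto_of_noBubble (h : IsModel 𝓕 P Q D) (h𝓕 : 𝓕 0 = ⊥)
    (hbub : NoBubble 𝓕 P ρ Q D) :
    Tendsto (fun t => ∫⁻ ω, discountedPenalty 𝓕 P ρ Q D t ω ∂Q) atTop (𝓝 0) := by
  have := h.isProbabilityMeasure
  obtain ⟨ω, hω⟩ := (hbub 0).exists
  simp only [bubble, h𝓕, condLExp_bot, Pi.zero_apply] at hω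
  exact tendsto_of_le_liminf_of_limsup_le zero_le hω.le

variable [IsFiniteMeasure P]

theorem IsModel.isPotential_of_tendsto (h : IsModel 𝓕 P Q D) (h𝓕 : 𝓕 0 = ⊥)
    (hρ : IsDynConvexRiskMeasure 𝓕 P ρ) (htc : TimeConsistent 𝓕 P ρ)
    (hfin : FinitePenalty 𝓕 P ρ Q D)
    (hlim : Tendsto (fun t => ∫⁻ ω, discountedPenalty 𝓕 P ρ Q D t ω ∂Q) atTop (𝓝 0)) :
    IsPotential 𝓕 Q (discountedPenalty 𝓕 P ρ Q D) where
  adapted := h.measurable_discountedPenalty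
  integrable := h.lintegral_discountedPenalty_ne_top h𝓕 hρ htc hfin
  supermartingale s t hst := by
    have := h.isProbabilityMeasure
    have key := h.condLExp_discountedPenalty_le hρ htc hst (le_refl s)
    rwa [condLExp_eq_self (𝓕.le s) Q (h.measurable_discountedPenalty s)] at key
  tendsto_zero := hlim

/-- For s ≥ t the bubble at t is at most E_Q[W_s | 𝓕_t], so its expectation is at most w_s → 0. -/
theorem IsModel.noBubble_of_isPotential (h : IsModel 𝓕 P Q D)
    (hρ : IsDynConvexRiskMeasure 𝓕 P ρ) (htc : TimeConsistent 𝓕 P ρ)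
    (hpot : IsPotential 𝓕 Q (discountedPenalty 𝓕 P ρ Q D)) : NoBubble 𝓕 P ρ Q D := by
  have := h.isProbabilityMeasure
  intro t
  have hm : Measurable (bubble 𝓕 P ρ Q D t) :=
    Measurable.limsup fun s => measurable_condLExp' _ _ _
  rw [← lintegral_eq_zero_iff hm]
  refine le_antisymm (ge_of_tendsto hpot.tendsto_zero ?_) zero_le
  filter_upwards [eventually_ge_atTop t] with s hs
  rw [← lintegral_condLExp (𝓕.le t) Q (discountedPenalty 𝓕 P ρ Q D s)]
  refine lintegral_mono_ae ?_
  have hall : ∀ᵐ ω ∂Q, ∀ u, s ≤ u → condLExp (𝓕 t) Q (discountedPenalty 𝓕 P ρ Q D u) ω ≤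
      condLExp (𝓕 t) Q (discountedPenalty 𝓕 P ρ Q D s) ω :=
    ae_all_iff.2 fun u => ae_all_iff.2 fun hu => h.condLExp_discountedPenalty_le hρ htc hu hs
  filter_upwards [hall] with ω hω
  exact limsup_le_of_le (by isBoundedDefault) ((eventually_ge_atTop s).mono hω)

/-! ### Asymptotic safety -/

/-- Fatou's lemma makes the lower limit of W zero, and the supermartingale W converges a.s. -/
theorem IsModel.tendsto_discountedPenalty (h : IsModel 𝓕 P Q D) (h𝓕 : 𝓕 0 = ⊥)
    (hρ : IsDynConvexRiskMeasure 𝓕 P ρ) (htc : TimeConsistent 𝓕 P ρ)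
    (hfin : FinitePenalty 𝓕 P ρ Q D)
    (hpot : IsPotential 𝓕 Q (discountedPenalty 𝓕 P ρ Q D)) :
    ∀ᵐ ω ∂Q, Tendsto (fun t => (discountedPenalty 𝓕 P ρ Q D t ω).toReal) atTop (𝓝 0) := by
  have hm : ∀ t, Measurable (discountedPenalty 𝓕 P ρ Q D t) := fun t =>
    (h.measurable_discountedPenalty t).mono (𝓕.le t) le_rfl
  have hint : ∫⁻ ω, liminf (fun t => discountedPenalty 𝓕 P ρ Q D t ω) atTop ∂Q = 0 :=
    le_antisymm ((lintegral_liminf_le hm).trans hpot.tendsto_zero.liminf_eq.le) zero_le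
  have hlimz := (lintegral_eq_zero_iff (Measurable.liminf hm)).1 hint
  filter_upwards [hlimz, h.ae_tendsto_discountedPenalty_add h𝓕 hρ htc hfin zero_mem_RInf,
    h.ae_abs_runningCost_le hρ zero_mem_RInf le_rfl fun _ => Eventually.of_forall fun _ => by simp,
    ae_all_iff.2 (h.ae_discountedPenalty_ne_top h𝓕 hρ htc hfin)] with ω h1 ⟨l, h2⟩ h3 h4
  have h0 : ∀ t, runningCost D ρ (fun _ _ => 0) 0 t ω = 0 := fun t => by
    simpa using h3 0 t (Nat.zero_le t)
  simp only [h0, add_zero] at h2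
  have hl0 : 0 ≤ l := ge_of_tendsto' h2 fun _ => ENNReal.toReal_nonneg
  have h5 : Tendsto (fun t => discountedPenalty 𝓕 P ρ Q D t ω) atTop (𝓝 (ENNReal.ofReal l)) :=
    (ENNReal.tendsto_ofReal h2).congr fun t => ENNReal.ofReal_toReal (h4 t)
  rw [h5.liminf_eq, Pi.zero_apply, ENNReal.ofReal_eq_zero] at h1
  rwa [le_antisymm h1 hl0] at h2

/-- The capital requirement dominates the conditional loss minus the penalty. -/
theorem IsModel.condTail_le (h : IsModel 𝓕 P Q D) (h𝓕 : 𝓕 0 = ⊥)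
    (hρ : IsDynConvexRiskMeasure 𝓕 P ρ) (htc : TimeConsistent 𝓕 P ρ)
    (hfin : FinitePenalty 𝓕 P ρ Q D) {X : ℕ∞ → Ω → ℝ} (hX : X ∈ RInf 𝓕 P) (t : ℕ) :
    ∀ᵐ ω ∂Q, condTail 𝓕 Q D t X ω ≤
      D t ω * ρ t (proj t X) ω + (discountedPenalty 𝓕 P ρ Q D t ω).toReal := by
  have := h.isProbabilityMeasure
  have hc := (hρ t).risk_mem hX
  have hV := cash_mem_RInf hc
  -- X plus the cash ρ_t(X) is acceptable, so its conditional loss, that of X minus D_t ρ_t(X), is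
  -- at most W_t.
  have hZ := (hρ t).add_risk_mem_acceptanceSet hX hc (ae_of_all _ fun _ => le_rfl)
  obtain ⟨C, hC0, hC⟩ := exists_bound hX
  obtain ⟨C', -, hC'⟩ := exists_bound hV
  set r : Ω → ℝ := runningCost D ρ X t t
  have hri : Integrable r Q := h.integrable_runningCost hρ hX le_rfl
  have hcongr : (fun ω => -tailSum D t
      (proj t fun r ω => X r ω + cash t (ρ t (proj t X)) r ω) ω) =ᵐ[Q]
      (fun ω => -tailSum D t X ω) - r := by
    filter_upwards [h.ae_regularPath, h.ae_pathBound hX hC, h.ae_pathBound hV hC'] with ω h1 h2 h3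
    rw [tailSum_proj, h1.tailSum_add h2 h3, h1.tailSum_cash, Pi.sub_apply]
    simp only [r, runningCost_self]
    ring
  filter_upwards [condExp_congr_ae (m := 𝓕 t) hcongr,
    condExp_sub (h.integrable_tailSum hX t).neg hri (𝓕 t), h.condTail_le_discountedPenalty hZ,
    h.ae_discountedPenalty_ne_top h𝓕 hρ htc hfin t] with ω h1 h2 h3 h4
  have h5 := ENNReal.toReal_mono h4 h3
  have h6 : Q[r | 𝓕 t] = r := condExp_of_stronglyMeasurable (𝓕.le t)
    (h.measurable_runningCost hρ hX t t).stronglyMeasurable hri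
  rw [h6] at h2
  have h7 : condTail 𝓕 Q D t (proj t fun r ω => X r ω + cash t (ρ t (proj t X)) r ω) ω =
      condTail 𝓕 Q D t X ω - r ω := h1.trans h2
  rw [h7, ENNReal.toReal_ofReal'] at h5
  have h8 := (le_max_left _ _).trans h5
  simp only [r, runningCost_self] at h8
  linarith

/-- A lower bound for the conditional loss, with the correct limit `-D_∞ X_∞`. -/
theorem IsModel.exists_tendsto_le_condTail (h : IsModel 𝓕 P Q D) {X : ℕ∞ → Ω → ℝ}
    (hX : X ∈ RInf 𝓕 P) : ∃ f : ℕ → Ω → ℝ, (∀ t, f t ≤ᵐ[Q] condTail 𝓕 Q D t X) ∧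
      ∀ᵐ ω ∂Q, Tendsto (fun t => f t ω) atTop (𝓝 (-(D ⊤ ω * X ⊤ ω))) := by
  have := h.isProbabilityMeasure
  obtain ⟨C, hC0, hC⟩ := exists_bound hX
  have hle : ⨆ n, 𝓕 n ≤ m := iSup_le 𝓕.le
  -- The finite-time part of the loss from t on is at least -C (D_t - D_∞), so the whole loss is at
  -- least g - C D_t. Lévy's upward theorem sends E_Q[g | 𝓕_t] to g, and the terms C D_∞ cancel in
  -- the limit.
  set g : Ω → ℝ := fun ω => C * D ⊤ ω - D ⊤ ω * X ⊤ ω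
  have hgm : Measurable[⨆ n, 𝓕 n] g :=
    (h.isDiscounting.measurable_top.const_mul C).sub (h.isDiscounting.measurable_top.mul (hX.1 ⊤))
  have hgi : Integrable g Q := by
    refine Integrable.of_bound (hgm.mono hle le_rfl).aestronglyMeasurable (C + C) ?_
    filter_upwards [h.ae_regularPath, h.ae_pathBound hX hC] with ω h1 h2
    have h3 := h1.abs_top_le h2
    have h4 := mul_le_of_le_one_right hC0 ((h1.top_le 0).trans (h1.le_one 0))
    refine (abs_sub _ _).trans (add_le_add ?_ (h3.trans h4))
    rwa [abs_of_nonneg (mul_nonneg hC0 h1.nonneg_top)]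
  have hDi : ∀ t : ℕ, Integrable (fun ω => C * D t ω) Q := by
    intro t
    refine Integrable.const_mul (Integrable.of_bound
      ((h.isDiscounting.measurable_coe t).mono (𝓕.le t) le_rfl).aestronglyMeasurable 1 ?_) C
    filter_upwards [h.ae_regularPath] with ω h1
    rw [Real.norm_eq_abs, abs_of_nonneg (h1.nonneg t)]
    exact h1.le_one t
  have hgself : Q[g | ⨆ n, 𝓕 n] = g :=
    condExp_of_stronglyMeasurable hle hgm.stronglyMeasurable hgi
  refine ⟨fun t ω => (Q[g | 𝓕 t]) ω - C * D t ω, fun t => ?_, ?_⟩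
  · have hself : Q[fun ω => C * D t ω | 𝓕 t] = fun ω => C * D t ω :=
      condExp_of_stronglyMeasurable (𝓕.le t)
        ((h.isDiscounting.measurable_coe t).const_mul C).stronglyMeasurable (hDi t)
    have hmono : Q[g - fun ω => C * D t ω | 𝓕 t] ≤ᵐ[Q] condTail 𝓕 Q D t X := by
      refine condExp_mono (hgi.sub (hDi t)) (h.integrable_tailSum hX t).neg ?_
      filter_upwards [h.ae_regularPath, h.ae_pathBound hX hC] with ω h1 h2
      have h3 := (abs_le.1 (h1.abs_tsum_le h2 t)).2
      have h4 : weight D ⊤ ω = D ⊤ ω := rfl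
      simp only [Pi.sub_apply, g, tailSum, h4]
      linarith
    filter_upwards [hmono, condExp_sub hgi (hDi t) (𝓕 t)] with ω h1 h2
    rw [h2, Pi.sub_apply, hself] at h1
    exact h1
  · filter_upwards [tendsto_ae_condExp (ℱ := 𝓕) (μ := Q) g, h.ae_regularPath] with ω h1 h2
    rw [hgself] at h1
    have := h1.sub (h2.tendsto.const_mul C)
    simpa [g] using this

theorem IsModel.asymptoticallySafe_of_isPotential (h : IsModel 𝓕 P Q D) (h𝓕 : 𝓕 0 = ⊥)
    (hρ : IsDynConvexRiskMeasure 𝓕 P ρ) (htc : TimeConsistent 𝓕 P ρ)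
    (hfin : FinitePenalty 𝓕 P ρ Q D)
    (hpot : IsPotential 𝓕 Q (discountedPenalty 𝓕 P ρ Q D)) : AsymptoticallySafe 𝓕 P ρ Q D := by
  intro X hX
  obtain ⟨f, hf, hflim⟩ := h.exists_tendsto_le_condTail hX
  filter_upwards [h.ae_tendsto_risk h𝓕 hρ htc hfin hX, h.ae_regularPath, hflim,
    h.tendsto_discountedPenalty h𝓕 hρ htc hfin hpot, ae_all_iff.2 hf,
    ae_all_iff.2 (h.condTail_le h𝓕 hρ htc hfin hX)] with ω h1 h2 h3 h4 h5 h6 hpos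
  obtain ⟨l, hl⟩ := h1 hpos
  have hle := le_of_tendsto_of_tendsto' h3 ((h2.tendsto.mul hl).add h4)
    fun t => (h5 t).trans (h6 t)
  rw [limitRisk, hl.limUnder_eq]
  rw [add_zero, ← mul_neg] at hle
  exact le_of_mul_le_mul_left hle hpos

/-- Under asymptotic safety, the running costs have a limit dominating the total loss. -/
theorem IsModel.integral_le_of_asymptoticallySafe (h : IsModel 𝓕 P Q D) (h𝓕 : 𝓕 0 = ⊥)
    (hρ : IsDynConvexRiskMeasure 𝓕 P ρ) (htc : TimeConsistent 𝓕 P ρ)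
    (hfin : FinitePenalty 𝓕 P ρ Q D) (hsafe : AsymptoticallySafe 𝓕 P ρ Q D)
    {X : ℕ∞ → Ω → ℝ} (hX : X ∈ RInf 𝓕 P) :
    ∃ L : ℝ, Tendsto (fun t => ∫ ω, runningCost D ρ X 0 t ω ∂Q) atTop (𝓝 L) ∧
      ∫ ω, -tailSum D 0 X ω ∂Q ≤ L := by
  have := h.isProbabilityMeasure
  obtain ⟨C, hC0, hC⟩ := exists_bound hX
  set U : Ω → ℝ := fun ω => limUnder atTop fun t => runningCost D ρ X 0 t ω
  have hUb := h.ae_abs_runningCost_le hρ hX hC0 hC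
  have hlim : ∀ᵐ ω ∂Q, Tendsto (fun t => runningCost D ρ X 0 t ω) atTop (𝓝 (U ω)) ∧
      -tailSum D 0 X ω ≤ U ω := by
    filter_upwards [h.ae_tendsto_mul_risk h𝓕 hρ htc hfin hX, h.ae_tendsto_risk h𝓕 hρ htc hfin hX,
      hsafe X hX, h.ae_regularPath, h.ae_pathBound hX hC, h.ae_abs_risk_le hρ hX hC]
      with ω ⟨l, hl⟩ h1 h2 h3 h4 h5
    have hs := (h3.summable h4 0).hasSum.tendsto_sum_nat
    have hU : Tendsto (fun t => runningCost D ρ X 0 t ω) atTop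
        (𝓝 (-(∑' k : ℕ, weight D (0 + k : ℕ) ω * X (0 + k : ℕ) ω) + l)) := by
      refine (hs.neg.add hl).congr fun t => ?_
      simp only [runningCost, Finset.range_eq_Ico, zero_add]
    have hlX : -(D ⊤ ω * X ⊤ ω) ≤ l := by
      -- On {D_∞ = 0} safety gives nothing, but D_t ρ_t(X) tends to 0 because ρ_t(X) is bounded.
      rcases h3.nonneg_top.eq_or_lt with h0 | h0
      · have hz : Tendsto (fun t : ℕ => D t ω * ρ t (proj t X) ω) atTop (𝓝 0) := by
          have hD := h3.tendsto.mul_const C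
          rw [← h0, zero_mul] at hD
          refine squeeze_zero_norm (fun t => ?_) hD
          rw [Real.norm_eq_abs, abs_mul, abs_of_nonneg (h3.nonneg t)]
          exact mul_le_mul_of_nonneg_left (h5 t) (h3.nonneg t)
        rw [tendsto_nhds_unique hl hz, ← h0]
        simp
      · obtain ⟨l', hl'⟩ := h1 h0
        have h2' := h2 h0
        rw [limitRisk, hl'.limUnder_eq] at h2'
        rw [tendsto_nhds_unique hl (h3.tendsto.mul hl'), ← mul_neg]
        exact mul_le_mul_of_nonneg_left h2' h0.le
    have hUeq : U ω = -(∑' k : ℕ, weight D (0 + k : ℕ) ω * X (0 + k : ℕ) ω) + l :=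
      hU.limUnder_eq
    refine ⟨hUeq ▸ hU, ?_⟩
    have hw : weight D ⊤ ω = D ⊤ ω := rfl
    rw [hUeq, tailSum, hw]
    linarith
  have hmeas : ∀ t, AEStronglyMeasurable (runningCost D ρ X 0 t) Q := fun t =>
    (h.integrable_runningCost hρ hX (Nat.zero_le t)).aestronglyMeasurable
  have hUi : Integrable U Q := by
    refine Integrable.of_bound
      (aestronglyMeasurable_of_tendsto_ae atTop hmeas (hlim.mono fun _ h => h.1)) C ?_
    filter_upwards [hlim, hUb] with ω h1 h2
    exact le_of_tendsto' h1.1.norm fun t => h2 0 t (Nat.zero_le t)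
  refine ⟨∫ ω, U ω ∂Q, ?_, ?_⟩
  · exact tendsto_integral_of_dominated_convergence (fun _ => C) hmeas (integrable_const C)
      (fun t => hUb.mono fun ω hω => hω 0 t (Nat.zero_le t)) (hlim.mono fun _ h => h.1)
  · exact integral_mono_ae (h.integrable_tailSum hX 0).neg hUi (hlim.mono fun _ h => h.2)

/-- Monotone convergence along the increasing conditional losses: w_t is a limit of expected losses
of acceptable positions. -/
theorem IsModel.exists_seq_tendsto_integral (h : IsModel 𝓕 P Q D) (h𝓕 : 𝓕 0 = ⊥)
    (hρ : IsDynConvexRiskMeasure 𝓕 P ρ) (htc : TimeConsistent 𝓕 P ρ)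
    (hfin : FinitePenalty 𝓕 P ρ Q D) (t : ℕ) :
    ∃ Y : ℕ → ℕ∞ → Ω → ℝ, (∀ n, Y n ∈ acceptanceSet 𝓕 P t (ρ t)) ∧
      Tendsto (fun n => ∫ ω, -tailSum D t (Y n) ω ∂Q) atTop
        (𝓝 (∫ ω, (discountedPenalty 𝓕 P ρ Q D t ω).toReal ∂Q)) := by
  have := h.isProbabilityMeasure
  obtain ⟨Y, hY, hYlim⟩ := h.exists_seq_discountedPenalty (hρ t)
  refine ⟨Y, hY, ?_⟩
  have hint : ∀ n, ∫ ω, -tailSum D t (Y n) ω ∂Q = ∫ ω, condTail 𝓕 Q D t (Y n) ω ∂Q := fun n =>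
    (integral_condExp (𝓕.le t)).symm
  simp only [hint]
  refine integral_tendsto_of_tendsto_of_monotone (fun n => integrable_condExp)
    (h.integrable_toReal_discountedPenalty h𝓕 hρ htc hfin t) (hYlim.mono fun ω hω => hω.1) ?_
  filter_upwards [hYlim, h.ae_discountedPenalty_ne_top h𝓕 hρ htc hfin t] with ω h1 h2
  have h3 : Tendsto (fun n => ENNReal.ofReal (condTail 𝓕 Q D t (Y n) ω)) atTop
      (𝓝 (discountedPenalty 𝓕 P ρ Q D t ω)) := by
    rw [h1.2.2]
    exact tendsto_atTop_iSup fun i j hij => ENNReal.ofReal_le_ofReal (h1.1 hij)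
  exact ((ENNReal.tendsto_toReal h2).comp h3).congr fun n => ENNReal.toReal_ofReal (h1.2.1 n)

theorem IsModel.isPotential_of_asymptoticallySafe (h : IsModel 𝓕 P Q D) (h𝓕 : 𝓕 0 = ⊥)
    (hρ : IsDynConvexRiskMeasure 𝓕 P ρ) (htc : TimeConsistent 𝓕 P ρ)
    (hfin : FinitePenalty 𝓕 P ρ Q D) (hsafe : AsymptoticallySafe 𝓕 P ρ Q D) :
    IsPotential 𝓕 Q (discountedPenalty 𝓕 P ρ Q D) := by
  have := h.isProbabilityMeasure
  refine h.isPotential_of_tendsto h𝓕 hρ htc hfin ?_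
  have hne := h.lintegral_discountedPenalty_ne_top h𝓕 hρ htc hfin
  set w : ℕ → ℝ := fun t => ∫ ω, (discountedPenalty 𝓕 P ρ Q D t ω).toReal ∂Q
  have hw : ∀ t, ENNReal.ofReal (w t) = ∫⁻ ω, discountedPenalty 𝓕 P ρ Q D t ω ∂Q := by
    intro t
    have hfinite := ae_lt_top ((h.measurable_discountedPenalty t).mono (𝓕.le t) le_rfl) (hne t)
    simp only [w]
    rw [integral_toReal ((h.measurable_discountedPenalty t).mono (𝓕.le t) le_rfl).aemeasurable
      hfinite, ENNReal.ofReal_toReal (hne t)]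
  have hw0 : ∀ t, 0 ≤ w t := fun t => integral_nonneg fun _ => ENNReal.toReal_nonneg
  have hwanti : Antitone w := by
    intro s t hst
    rw [← ENNReal.ofReal_le_ofReal_iff (hw0 s), hw, hw]
    exact h.lintegral_discountedPenalty_antitone hρ htc hst
  have hwlim := tendsto_atTop_ciInf hwanti ⟨0, by rintro _ ⟨t, rfl⟩; exact hw0 t⟩
  -- The initial running cost is ρ_0(X) ≤ 0, so w_t plus the expected running cost up to t is at
  -- most w_0; safety bounds the limit of that cost below by the total loss.
  have hbound : ∀ X ∈ acceptanceSet 𝓕 P 0 (ρ 0),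
      (⨅ t, w t) + ∫ ω, -tailSum D 0 X ω ∂Q ≤ w 0 := by
    intro X hX
    have hXR := RInfFrom_subset hX.1
    obtain ⟨L, hL, hLle⟩ := h.integral_le_of_asymptoticallySafe h𝓕 hρ htc hfin hsafe hXR
    have hi := h.integrable_toReal_discountedPenalty h𝓕 hρ htc hfin
    have hstep : ∀ t, w t + ∫ ω, runningCost D ρ X 0 t ω ∂Q ≤ w 0 := by
      intro t
      have hr := fun t => h.integrable_runningCost hρ hXR (Nat.zero_le t)
      have key := h.setIntegral_discountedPenalty_add_le h𝓕 hρ htc hfin hXR (Nat.zero_le t)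
        (B := univ) MeasurableSet.univ
      rw [setIntegral_univ, setIntegral_univ, integral_add (hi t) (hr t),
        integral_add (hi 0) (hr 0)] at key
      refine key.trans (add_le_of_nonpos_right (integral_nonpos_of_ae ?_))
      have hneg : ∀ᵐ ω ∂Q, ρ 0 X ω ≤ 0 :=
        h.ae_of_ae (p := fun ω => ρ 0 X ω ≤ 0) (@measurableSet_le _ _ _ _ _ (𝓕 0) _ _ _ _ _
          ((hρ 0).mapsTo X hX.1).1 measurable_const) hX.2
      filter_upwards [hneg, h.ae_regularPath] with ω h1 h2
      rw [runningCost_self, proj_eq_self hX.1]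
      exact mul_nonpos_of_nonneg_of_nonpos (h2.nonneg 0) h1
    exact (add_le_add_right hLle _).trans (le_of_tendsto' (hwlim.add hL) hstep)
  obtain ⟨Y, hY, hYlim⟩ := h.exists_seq_tendsto_integral h𝓕 hρ htc hfin 0
  -- Expected losses of acceptable X approach w_0 itself, which leaves no room for a positive limit
  -- of w_t.
  have hle : (⨅ t, w t) + w 0 ≤ w 0 :=
    le_of_tendsto' (hYlim.const_add _) fun n => hbound _ (hY n)
  have hzero : (⨅ t, w t) = 0 := le_antisymm (by linarith) (le_ciInf hw0)
  rw [hzero] at hwlim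
  simpa [hw] using ENNReal.tendsto_ofReal hwlim

/-! ### Absolutely continuous models -/

theorem productMeasure_prod_top {A : Set Ω} (hA : MeasurableSet[⨆ n, 𝓕 n] A) :
    productMeasure 𝓕 Q D (A ×ˢ {⊤}) = ∫⁻ ω in A, ENNReal.ofReal (D ⊤ ω) ∂Q := by
  have hAm : MeasurableSet A := (iSup_le 𝓕.le : ⨆ n, 𝓕 n ≤ m) _ hA
  have hB : MeasurableSet[optionalSigma 𝓕] (A ×ˢ {(⊤ : ℕ∞)}) :=
    MeasurableSpace.measurableSet_generateFrom ⟨⊤, A, hA, rfl⟩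
  rw [productMeasure, @Measure.sum_apply _ _ (optionalSigma 𝓕) _ _ hB, tsum_eq_single ⊤]
  · rw [@Measure.map_apply _ _ m (optionalSigma 𝓕) _ _ (measurable_section 𝓕 ⊤) _ hB]
    have : (fun ω : Ω => (ω, (⊤ : ℕ∞))) ⁻¹' (A ×ˢ {⊤}) = A := by ext; simp
    rw [this, withDensity_apply _ hAm]
    rfl
  · intro t ht
    rw [@Measure.map_apply _ _ m (optionalSigma 𝓕) _ _ (measurable_section 𝓕 t) _ hB]
    have : (fun ω : Ω => (ω, t)) ⁻¹' (A ×ˢ {⊤}) = ∅ := by ext; simp [ht]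
    rw [this, measure_empty]

/-- On the slice at time ∞ the model has density D_∞ with respect to Q, so domination between models
transfers statements of the form "a.s. on {D_∞ > 0}". -/
theorem productMeasure_prod_top_eq_zero_iff (hD : Measurable[sigmaAt 𝓕 ⊤] (D ⊤)) {A : Set Ω}
    (hA : MeasurableSet[⨆ n, 𝓕 n] A) :
    productMeasure 𝓕 Q D (A ×ˢ {⊤}) = 0 ↔ ∀ᵐ ω ∂Q, 0 < D ⊤ ω → ω ∉ A := by
  have hAm : MeasurableSet A := (iSup_le 𝓕.le : ⨆ n, 𝓕 n ≤ m) _ hA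
  have hDm : Measurable fun ω => ENNReal.ofReal (D ⊤ ω) :=
    ENNReal.measurable_ofReal.comp (hD.mono (sigmaAt_le 𝓕 ⊤) le_rfl)
  rw [productMeasure_prod_top hA, lintegral_eq_zero_iff hDm, Filter.EventuallyEq,
    ae_restrict_iff' hAm]
  refine eventually_congr (Eventually.of_forall fun ω => ?_)
  simp only [Pi.zero_apply, ENNReal.ofReal_eq_zero]
  exact ⟨fun h1 h2 h3 => absurd (h1 h3) (not_le.2 h2), fun h1 h2 => not_lt.1 fun h3 => h1 h3 h2⟩

/-- Asymptotic safety is inherited by absolutely continuous models. -/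
theorem AsymptoticallySafe.of_absolutelyContinuous (h : IsModel 𝓕 P Q D) (h𝓕 : 𝓕 0 = ⊥)
    (hρ : IsDynConvexRiskMeasure 𝓕 P ρ) (htc : TimeConsistent 𝓕 P ρ)
    (hfin : FinitePenalty 𝓕 P ρ Q D) (hsafe : AsymptoticallySafe 𝓕 P ρ Q D)
    {R : Measure Ω} {E : ℕ∞ → Ω → ℝ} (hR : IsModel 𝓕 P R E)
    (hac : productMeasure 𝓕 R E ≪ productMeasure 𝓕 Q D) : AsymptoticallySafe 𝓕 P ρ R E := by
  intro X hX
  have hm : ∀ t : ℕ, Measurable[⨆ n, 𝓕 n] (ρ t (proj t X)) := fun t =>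
    ((hρ t).risk_mem hX).1.mono (le_iSup (fun n => 𝓕 n) t) le_rfl
  -- The safety event must lie in 𝓕_∞. Requiring convergence and using the upper limit in place of
  -- the limit makes this measurability immediate.
  set G : Set Ω := {ω | ∃ l : ℝ, Tendsto (fun t : ℕ => ρ t (proj t X) ω) atTop (𝓝 l)} ∩
    {ω | -X ⊤ ω ≤ limsup (fun t : ℕ => ρ t (proj t X) ω) atTop}
  have hG : MeasurableSet[⨆ n, 𝓕 n] G := by
    refine MeasurableSet.inter
      (@measurableSet_exists_tendsto _ _ _ (⨆ n, 𝓕 n) _ _ _ _ _ _ _ _ _ hm) ?_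
    exact @measurableSet_le _ _ _ _ _ (⨆ n, 𝓕 n) _ _ _ _ _ (hX.1 ⊤).neg (Measurable.limsup hm)
  have hQ : ∀ᵐ ω ∂Q, 0 < D ⊤ ω → ω ∉ Gᶜ := by
    filter_upwards [h.ae_tendsto_risk h𝓕 hρ htc hfin hX, hsafe X hX] with ω h1 h2 hpos
    obtain ⟨l, hl⟩ := h1 hpos
    have h3 := h2 hpos
    rw [limitRisk, hl.limUnder_eq, ← hl.limsup_eq] at h3
    exact not_not.2 ⟨⟨l, hl⟩, h3⟩
  have hRG := (productMeasure_prod_top_eq_zero_iff hR.isDiscounting.measurable_top hG.compl).1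
    (hac ((productMeasure_prod_top_eq_zero_iff h.isDiscounting.measurable_top hG.compl).2 hQ))
  filter_upwards [hRG] with ω h1 hpos
  obtain ⟨⟨l, hl⟩, h2⟩ := not_not.1 (h1 hpos)
  rw [limitRisk, hl.limUnder_eq, ← hl.limsup_eq]
  exact h2

end

end RiskProcess

end

/-! ### Existence of the limit and the cycle of implications 1 → 4 → 2 → 3 → 1 -/

theorem theorem4p6 {Ω : Type*} {m : MeasurableSpace Ω} (𝓕 : Filtration ℕ m) (h𝓕 : 𝓕 0 = ⊥)
    (P : Measure Ω) [IsProbabilityMeasure P]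
    (ρ : ℕ → (ℕ∞ → Ω → ℝ) → Ω → ℝ)
    (hρ : RiskProcess.IsDynConvexRiskMeasure 𝓕 P ρ)
    (hcont : ∀ t, RiskProcess.ContinuousFromAbove 𝓕 P t (ρ t))
    (htc : RiskProcess.TimeConsistent 𝓕 P ρ)
    (Q : Measure Ω) (D : ℕ∞ → Ω → ℝ) (hQD : RiskProcess.IsModel 𝓕 P Q D)
    (hfin : RiskProcess.FinitePenalty 𝓕 P ρ Q D) :
    -- the limits defining `ρ_∞(X)` exist
    (∀ X ∈ RiskProcess.RInf 𝓕 P, ∀ᵐ ω ∂Q, 0 < D ⊤ ω →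
      ∃ l : ℝ, Tendsto (fun t : ℕ => ρ t (RiskProcess.proj t X) ω) atTop (𝓝 l)) ∧
    List.TFAE [
      RiskProcess.AsymptoticallySafe 𝓕 P ρ Q D,
      RiskProcess.NoBubble 𝓕 P ρ Q D,
      RiskProcess.IsPotential 𝓕 Q (RiskProcess.discountedPenalty 𝓕 P ρ Q D),
      ∀ (R : Measure Ω) (E : ℕ∞ → Ω → ℝ), RiskProcess.IsModel 𝓕 P R E →
        RiskProcess.productMeasure 𝓕 R E ≪ RiskProcess.productMeasure 𝓕 Q D →
        RiskProcess.FinitePenalty 𝓕 P ρ R E → RiskProcess.NoBubble 𝓕 P ρ R E] := by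
  refine ⟨fun X hX => hQD.ae_tendsto_risk h𝓕 hρ htc hfin hX, ?_⟩
  tfae_have 1 → 4 := fun hsafe R E hR hac hRfin =>
    hR.noBubble_of_isPotential hρ htc (hR.isPotential_of_asymptoticallySafe h𝓕 hρ htc hRfin
      (hsafe.of_absolutelyContinuous hQD h𝓕 hρ htc hfin hR hac))
  tfae_have 4 → 2 := fun hall => hall Q D hQD Measure.AbsolutelyContinuous.rfl hfin
  tfae_have 2 → 3 := fun hbub =>
    hQD.isPotential_of_tendsto h𝓕 hρ htc hfin (hQD.tendsto_of_noBubble h𝓕 hbub)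
  tfae_have 3 → 1 := hQD.asymptoticallySafe_of_isPotential h𝓕 hρ htc hfin
  tfae_finish
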